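/- Let $n\in\mathbb N$, $T>0$, $\alpha\in(0,1)$; $\|\cdot\|$ and $\langle\cdot,\cdot\rangle$ are the Euclidean norm and inner product of $\mathbb R^n$. **Paths.** For $\psi\in L^\infty([0,t],\mathbb R^n)$ and $\beta>0$ put $(I^\beta\psi)(\tau)=\frac1{\Gamma(\beta)}\int_0^\tau\frac{\psi(\xi)}{(\tau-\xi)^{1-\beta}}\,d\xi$. Let $AC^\alpha([0,t],\mathbb R^n)\subset C([0,t],\mathbb R^n)$ (with the maximum norm) be the set of functions of the form $x(\tau)=x(0)+(I^\alpha\psi)(\tau)$, $\tau\in[0,t]$, with $\psi\in L^\infty([0,t],\mathbb R^n)$; for such $x$ the Caputo derivative $({}^CD^\alpha x)(\tau)=\frac{d}{d\tau}\big(I^{1-\alpha}(x(\cdot)-x(0))\big)(\tau)$ exists for a.e. $\tau$. Let $G$ be the set of pairs $(t,w)$ with $t\in[0,T]$ and $w\in C([0,t],\mathbb R^n)$, with the metric $\mathrm{dist}(p,p')=\max\{\mathrm{dist}^*(p,p'),\mathrm{dist}^*(p',p)\}$, where $$\mathrm{dist}^*((t,w),(t',w'))=\max_{\tau\in[0,t]}\min_{\tau'\in[0,t']}\sqrt{|\tau-\tau'|^2+\|w(\tau)-w'(\tau')\|^2}.$$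 Let $G^\alpha=\{(t,w)\in G: w\in AC^\alpha([0,t],\mathbb R^n)\}$ and $G^{\alpha\circ}=\{(t,w)\in G^\alpha: t<T\}$, with the induced metric. Write $x_t$ for the restriction of $x$ to $[0,t]$. **Data.** Let $H:[0,T]\times\mathbb R^n\times\mathbb R^n\to\mathbb R$ be continuous, and let $c_H>0$ be such that $|H(t,x,s)-H(t,x,s')|\le c_H(1+\|x\|)\|s-s'\|$ for all $t,x,s,s'$. Suppose that for every $R\ge0$ there is $\lambda_H>0$ with $|H(t,x,s)-H(t,x',s)|\le\lambda_H(1+\|s\|)\|x-x'\|$ for all $t$, $s$ and all $x,x'$ with $\|x\|,\|x'\|\le R$. Let $\sigma:AC^\alpha([0,T],\mathbb R^n)\to\mathbb R$ be continuous. **Classical solutions.** A functional $\varphi:G^\alpha\to\mathbb R$ is $ci$-differentiable of order $\alpha$ at $(t_0,w_0)\in G^{\alpha\circ}$, with $ci$-derivatives $\partial_t^\alpha\varphi(t_0,w_0)\in\mathbb R$ and $\nabla^\alpha\varphi(t_0,w_0)\in\mathbb R^n$, if for every $x\in AC^\alpha([0,T],\mathbb R^n)$ with $x=w_0$ on $[0,t_0]$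 $$\varphi(t,x_t)-\varphi(t_0,w_0)=\partial_t^\alpha\varphi(t_0,w_0)(t-t_0)+\int_{t_0}^t\langle\nabla^\alpha\varphi(t_0,w_0),({}^CD^\alpha x)(\tau)\rangle\,d\tau+o(t-t_0),\quad t\to t_0+0,$$ where the remainder may depend on $x$. It is $ci$-smooth of order $\alpha$ if it is continuous, $ci$-differentiable of order $\alpha$ at every point of $G^{\alpha\circ}$, and $\partial_t^\alpha\varphi$, $\nabla^\alpha\varphi$ are continuous on $G^{\alpha\circ}$. A classical solution is a $ci$-smooth functional $\varphi$ of order $\alpha$ with $$\partial_t^\alpha\varphi(t,w)+H(t,w(t),\nabla^\alpha\varphi(t,w))=0\quad\text{for } (t,w)\in G^{\alpha\circ},\qquad \varphi(T,w)=\sigma(w)\quad\text{for } w\in AC^\alpha([0,T],\mathbb R^n).$$ **Minimax solutions.** For $(t_0,w_0)\in G^\alpha$, $z_0\in\mathbb R$ and $s\in\mathbb R^n$ let $CH(t_0,w_0,z_0,s)$ be the set of pairs $(x,z)$ of a function $x\in AC^\alpha([0,T],\mathbb R^n)$ and a Lipschitz function $z:[0,T]\to\mathbb R$ with $x=w_0$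 and $z=z_0$ on $[0,t_0]$ and, for a.e. $t\in[t_0,T]$, $$\|({}^CD^\alpha x)(t)\|\le c_H(1+\|x(t)\|),\qquad \dot z(t)=\langle s,({}^CD^\alpha x)(t)\rangle-H(t,x(t),s).$$ An upper solution is a lower semicontinuous $\varphi:G^\alpha\to\mathbb R$ with $\varphi(T,\cdot)\ge\sigma$ on $AC^\alpha([0,T],\mathbb R^n)$ such that for all $(t_0,w_0)\in G^{\alpha\circ}$, $t\in(t_0,T]$, $s\in\mathbb R^n$, $\varepsilon>0$ there is $(x,z)\in CH(t_0,w_0,0,s)$ with $\varphi(t,x_t)-z(t)\le\varphi(t_0,w_0)+\varepsilon$. A lower solution is an upper semicontinuous $\varphi:G^\alpha\to\mathbb R$ with $\varphi(T,\cdot)\le\sigma$ on $AC^\alpha([0,T],\mathbb R^n)$ such that for all such $(t_0,w_0),t,s,\varepsilon$ there is $(x,z)\in CH(t_0,w_0,0,s)$ with $\varphi(t,x_t)-z(t)\ge\varphi(t_0,w_0)-\varepsilon$. A minimax solution is a functional that is both an upper and a lower solution. **Theorem.** Every classical solution $\varphi$ is a minimax solution. Moreover, for every $(t_0,w_0)\in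 G^{\alpha\circ}$ and every $s\in\mathbb R^n$ there is $(x,z)\in CH(t_0,w_0,0,s)$ such that $\varphi(t,x_t)-z(t)=\varphi(t_0,w_0)$ for all $t\in[t_0,T]$. -/

import Mathlib

noncomputable section

namespace FracHJ

open Set MeasureTheory

/-- `ℝⁿ` with the Euclidean norm and inner product. -/
abbrev Vec (n : ℕ) : Type := EuclideanSpace ℝ (Fin n)

/-- The extension by zero to `ℝ` of a function given on `[0, t]`. It only serves to write
integrals, derivatives and values at real arguments; its values off `[0, t]` play no role. -/
def ext {t : ℝ} {F : Type} [Zero F] (x : Icc (0 : ℝ) t → F) : ℝ → F :=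
  Function.extend Subtype.val x 0

/-- The left-sided Riemann--Liouville fractional integral of order `α > 0`:
`(I^α ψ)(τ) = Γ(α)⁻¹ ∫₀^τ ψ(ξ) / (τ - ξ)^(1 - α) dξ`. -/
def fracInt {n : ℕ} (α : ℝ) (ψ : ℝ → Vec n) (τ : ℝ) : Vec n :=
  (1 / Real.Gamma α) • ∫ ξ in (0 : ℝ)..τ, (1 / (τ - ξ) ^ (1 - α)) • ψ ξ

/-- `x ∈ AC^α([0, t], ℝⁿ)`: there is an essentially bounded measurable `ψ` on `[0, t]` with
`x(τ) = x(0) + (I^α ψ)(τ)` for all `τ ∈ [0, t]`. -/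
def IsAC {n : ℕ} (α : ℝ) {t : ℝ} (x : C(Icc (0 : ℝ) t, Vec n)) : Prop :=
  ∃ ψ : ℝ → Vec n, MemLp ψ ⊤ (volume.restrict (Icc 0 t)) ∧
    ∀ τ : Icc (0 : ℝ) t,
      x τ = x ⟨0, le_rfl, τ.2.1.trans τ.2.2⟩ + fracInt α ψ (τ : ℝ)

/-- The Caputo derivative of order `α`:
`(ᶜD^α x)(τ) = d/dτ (I^(1 - α) (x(·) - x(0)))(τ)`. -/
def caputo {n : ℕ} (α : ℝ) {t : ℝ} (x : C(Icc (0 : ℝ) t, Vec n)) (τ : ℝ) : Vec n :=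
  deriv (fracInt (1 - α) (fun ξ => ext x ξ - ext x 0)) τ

/-- The set `G_n` of pairs `(t, w)` with `t ∈ [0, T]` and `w ∈ C([0, t], ℝⁿ)`. -/
structure Hist (T : ℝ) (n : ℕ) where
  t : Icc (0 : ℝ) T
  w : C(Icc (0 : ℝ) t, Vec n)

/-- The Euclidean distance in `ℝ × ℝⁿ` between `(τ, w(τ))` and `(τ', w'(τ'))`. -/
def graphDist {T : ℝ} {n : ℕ} (p q : Hist T n)
    (τ : Icc (0 : ℝ) p.t) (τ' : Icc (0 : ℝ) q.t) : ℝ :=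
  Real.sqrt (|(τ : ℝ) - τ'| ^ 2 + ‖p.w τ - q.w τ'‖ ^ 2)

/-- `dist*(p, q) = max_τ min_τ' graphDist`; both extrema are attained, by continuity and
compactness, so they are written as a supremum and an infimum. -/
def distStar {T : ℝ} {n : ℕ} (p q : Hist T n) : ℝ :=
  ⨆ τ : Icc (0 : ℝ) p.t, ⨅ τ' : Icc (0 : ℝ) q.t, graphDist p q τ τ'

/-- The distance on `G_n`. -/
def histDist {T : ℝ} {n : ℕ} (p q : Hist T n) : ℝ :=
  max (distStar p q) (distStar q p)

theorem graphDist_eq {T : ℝ} {n : ℕ} (p q : Hist T n)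
    (τ : Icc (0 : ℝ) p.t) (τ' : Icc (0 : ℝ) q.t) :
    graphDist p q τ τ' = dist (WithLp.toLp 2 ((τ : ℝ), p.w τ) : WithLp 2 (ℝ × Vec n))
      (WithLp.toLp 2 ((τ' : ℝ), q.w τ')) := by
  rw [WithLp.prod_dist_eq_of_L2]
  simp [graphDist, dist_eq_norm]

theorem graphDist_nonneg {T : ℝ} {n : ℕ} (p q : Hist T n)
    (τ : Icc (0 : ℝ) p.t) (τ' : Icc (0 : ℝ) q.t) : 0 ≤ graphDist p q τ τ' :=
  Real.sqrt_nonneg _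

instance instNonemptyHistDomain {T : ℝ} {n : ℕ} (p : Hist T n) : Nonempty (Icc (0 : ℝ) p.t) :=
  ⟨⟨0, le_rfl, p.t.2.1⟩⟩

theorem bddBelow_graphDist {T : ℝ} {n : ℕ} (p q : Hist T n) (τ : Icc (0 : ℝ) p.t) :
    BddBelow (range fun τ' => graphDist p q τ τ') :=
  ⟨0, by rintro _ ⟨τ', rfl⟩; exact graphDist_nonneg p q τ τ'⟩

theorem bddAbove_iInf_graphDist {T : ℝ} {n : ℕ} (p q : Hist T n) :
    BddAbove (range fun τ => ⨅ τ', graphDist p q τ τ') := by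
  let τ₀ : Icc (0 : ℝ) q.t := ⟨0, le_rfl, q.t.2.1⟩
  have hc : Continuous fun τ => graphDist p q τ τ₀ := by
    unfold graphDist; fun_prop
  obtain ⟨C, hC⟩ := (isCompact_range hc).bddAbove
  refine ⟨C, ?_⟩
  rintro _ ⟨τ, rfl⟩
  exact (ciInf_le (bddBelow_graphDist p q τ) τ₀).trans (hC ⟨τ, rfl⟩)

theorem iInf_le_distStar {T : ℝ} {n : ℕ} (p q : Hist T n) (τ : Icc (0 : ℝ) p.t) :
    ⨅ τ', graphDist p q τ τ' ≤ distStar p q :=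
  le_ciSup (bddAbove_iInf_graphDist p q) τ

theorem distStar_nonneg {T : ℝ} {n : ℕ} (p q : Hist T n) : 0 ≤ distStar p q :=
  Real.iSup_nonneg fun τ => Real.iInf_nonneg fun τ' => graphDist_nonneg p q τ τ'

theorem distStar_self {T : ℝ} {n : ℕ} (p : Hist T n) : distStar p p = 0 := by
  refine le_antisymm (ciSup_le fun τ => ?_) (distStar_nonneg p p)
  refine (ciInf_le (bddBelow_graphDist p p τ) τ).trans ?_
  simp [graphDist]

theorem distStar_triangle {T : ℝ} {n : ℕ} (p q r : Hist T n) :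
    distStar p r ≤ distStar p q + distStar q r := by
  refine ciSup_le fun τ => ?_
  refine le_trans ?_ (add_le_add_left (iInf_le_distStar p q τ) _)
  rw [← sub_le_iff_le_add]
  refine le_ciInf fun τ' => ?_
  rw [sub_le_iff_le_add]
  refine le_trans ?_ (add_le_add_right (iInf_le_distStar q r τ') _)
  rw [← sub_le_iff_le_add']
  refine le_ciInf fun τ'' => ?_
  rw [sub_le_iff_le_add']
  refine (ciInf_le (bddBelow_graphDist p r τ) τ'').trans ?_
  simp only [graphDist_eq]
  exact dist_triangle _ _ _

/-- `G_n` is considered with the distance `histDist` and the topology that it induces. -/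
instance instHistMetric {T : ℝ} {n : ℕ} : PseudoMetricSpace (Hist T n) where
  dist := histDist
  dist_self p := by simp [histDist, distStar_self]
  dist_comm p q := max_comm _ _
  dist_triangle p q r := by
    refine max_le ((distStar_triangle p q r).trans ?_) ((distStar_triangle r q p).trans ?_)
    · exact add_le_add (le_max_left _ _) (le_max_left _ _)
    · rw [add_comm]
      exact add_le_add (le_max_right _ _) (le_max_right _ _)

/-- The set `G_n^α` of the `(t, w) ∈ G_n` with `w ∈ AC^α([0, t], ℝⁿ)`. -/
abbrev ACHist (T : ℝ) (n : ℕ) (α : ℝ) : Type := {p : Hist T n // IsAC α p.w}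

/-- The set `G_n^{α∘}` of the `(t, w) ∈ G_n^α` with `t < T`. -/
abbrev ACHistInt (T : ℝ) (n : ℕ) (α : ℝ) : Type :=
  {p : ACHist T n α // (p.1.t : ℝ) < T}

/-- The set `AC^α([0, T], ℝⁿ)` as a subspace of `C([0, T], ℝⁿ)` with the maximum norm. -/
abbrev ACPath (T : ℝ) (n : ℕ) (α : ℝ) : Type := {x : C(Icc (0 : ℝ) T, Vec n) // IsAC α x}

theorem IsAC.restrict {n : ℕ} {α T : ℝ} {x : C(Icc (0 : ℝ) T, Vec n)} (hx : IsAC α x)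
    (t : Icc (0 : ℝ) T) :
    IsAC α (x.comp (ContinuousMap.inclusion (Icc_subset_Icc_right t.2.2))) := by
  obtain ⟨ψ, hψ, h⟩ := hx
  refine ⟨ψ, hψ.mono_measure (Measure.restrict_mono (Icc_subset_Icc_right t.2.2) le_rfl), ?_⟩
  intro τ
  exact h ⟨τ, τ.2.1, τ.2.2.trans t.2.2⟩

/-- The pair `(t, x_t)`, where `x_t` is the restriction of `x` to `[0, t]`. -/
def ACPath.upTo {T : ℝ} {n : ℕ} {α : ℝ} (x : ACPath T n α) (t : Icc (0 : ℝ) T) :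
    ACHist T n α :=
  ⟨⟨t, x.1.comp (ContinuousMap.inclusion (Icc_subset_Icc_right t.2.2))⟩, x.2.restrict t⟩

/-- `x` is an extension of `w₀`, where `p = (t₀, w₀)`: `x(τ) = w₀(τ)` for all `τ ∈ [0, t₀]`. -/
def Extends {T : ℝ} {n : ℕ} {α : ℝ} (x : ACPath T n α) (p : ACHist T n α) : Prop :=
  ∀ τ : Icc (0 : ℝ) p.1.t, x.1 ⟨τ, τ.2.1, τ.2.2.trans p.1.t.2.2⟩ = p.1.w τ

/-- `φ` is `ci`-differentiable of order `α` at `p = (t₀, w₀)` with the `ci`-derivatives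
`a = ∂_t^α φ(t₀, w₀)` and `v = ∇^α φ(t₀, w₀)`. -/
def HasCiDerivAt {T : ℝ} {n : ℕ} {α : ℝ} (φ : ACHist T n α → ℝ) (p : ACHistInt T n α)
    (a : ℝ) (v : Vec n) : Prop :=
  ∀ x : ACPath T n α, Extends x p.1 →
    ∀ ε > 0, ∃ δ > 0, ∀ t : Icc (0 : ℝ) T,
      (p.1.1.t : ℝ) < t → (t : ℝ) < T → (t : ℝ) - p.1.1.t < δ →
        |φ (x.upTo t) - φ p.1 - (a * ((t : ℝ) - p.1.1.t)
          + ∫ τ in (p.1.1.t : ℝ)..t, inner ℝ v (caputo α x.1 τ))| ≤ ε * ((t : ℝ) - p.1.1.t)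

/-- `φ` is `ci`-smooth of order `α`, with the `ci`-derivatives `φt` and `φx`. -/
structure IsCiSmooth {T : ℝ} {n : ℕ} {α : ℝ} (φ : ACHist T n α → ℝ)
    (φt : ACHistInt T n α → ℝ) (φx : ACHistInt T n α → Vec n) : Prop where
  continuous : Continuous φ
  hasCiDerivAt : ∀ p, HasCiDerivAt φ p (φt p) (φx p)
  continuous_dt : Continuous φt
  continuous_grad : Continuous φx

/-- The assumptions on the Hamiltonian `H` on `[0, T] × ℝⁿ × ℝⁿ`, `cH` being the constant of the
Lipschitz condition in the last variable. -/
structure HamiltonianAssumptions {n : ℕ} (T cH : ℝ) (H : ℝ → Vec n → Vec n → ℝ) : Prop where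
  continuousOn : ContinuousOn (fun y : ℝ × Vec n × Vec n => H y.1 y.2.1 y.2.2)
    (Icc 0 T ×ˢ univ)
  pos : 0 < cH
  lipschitz_grad : ∀ t ∈ Icc 0 T, ∀ x s s' : Vec n,
    |H t x s - H t x s'| ≤ cH * (1 + ‖x‖) * ‖s - s'‖
  lipschitz_state : ∀ R : ℝ, 0 ≤ R → ∃ L > 0, ∀ t ∈ Icc 0 T, ∀ x x' s : Vec n,
    ‖x‖ ≤ R → ‖x'‖ ≤ R → |H t x s - H t x' s| ≤ L * (1 + ‖s‖) * ‖x - x'‖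

/-- The value `w(t)` of the path at the last instant, for `p = (t, w)`. -/
def ACHist.last {T : ℝ} {n : ℕ} {α : ℝ} (p : ACHist T n α) : Vec n :=
  p.1.w ⟨p.1.t, p.1.t.2.1, le_rfl⟩

/-- A classical solution: a `ci`-smooth functional of order `α` satisfying
`∂_t^α φ(t, w) + H(t, w(t), ∇^α φ(t, w)) = 0` for `t < T` and `φ(T, w) = σ(w)`. -/
def IsClassicalSolution {T : ℝ} {n : ℕ} {α : ℝ} (H : ℝ → Vec n → Vec n → ℝ)
    (σ : ACPath T n α → ℝ) (φ : ACHist T n α → ℝ) : Prop :=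
  ∃ (φt : ACHistInt T n α → ℝ) (φx : ACHistInt T n α → Vec n), IsCiSmooth φ φt φx ∧
    (∀ p, φt p + H p.1.1.t (ACHist.last p.1) (φx p) = 0) ∧
    ∀ (w : ACPath T n α) (t : Icc (0 : ℝ) T), (t : ℝ) = T → φ (w.upTo t) = σ w

/-- The set `E(t, x, s)`. -/
def charSet {n : ℕ} (cH : ℝ) (H : ℝ → Vec n → Vec n → ℝ) (t : ℝ) (x s : Vec n) :
    Set (Vec n × ℝ) :=
  {y | ‖y.1‖ ≤ cH * (1 + ‖x‖) ∧ y.2 = inner ℝ s y.1 - H t x s}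

/-- The set `CH(t₀, w₀, z₀, s)` of characteristics, for `p = (t₀, w₀)`: pairs of
`x ∈ AC^α([0, T], ℝⁿ)` and a Lipschitz `z` on `[0, T]` with `x = w₀` and `z = z₀` on `[0, t₀]` and
`((ᶜD^α x)(t), ż(t)) ∈ E(t, x(t), s)` for a.e. `t ∈ [t₀, T]`. -/
def characteristics {T : ℝ} {n : ℕ} {α : ℝ} (cH : ℝ) (H : ℝ → Vec n → Vec n → ℝ)
    (p : ACHist T n α) (z₀ : ℝ) (s : Vec n) : Set (ACPath T n α × (Icc (0 : ℝ) T → ℝ)) :=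
  {y | (∃ K, LipschitzWith K y.2) ∧ Extends y.1 p ∧
    (∀ t : Icc (0 : ℝ) T, (t : ℝ) ≤ p.1.t → y.2 t = z₀) ∧
    ∀ᵐ t ∂(volume.restrict (Icc (p.1.t : ℝ) T)),
      (caputo α y.1.1 t, deriv (ext y.2) t) ∈ charSet cH H t (ext y.1.1 t) s}

structure IsUpperSolution {T : ℝ} {n : ℕ} {α : ℝ} (cH : ℝ) (H : ℝ → Vec n → Vec n → ℝ)
    (σ : ACPath T n α → ℝ) (φ : ACHist T n α → ℝ) : Prop where
  lowerSemicontinuous : LowerSemicontinuous φ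
  boundary : ∀ (w : ACPath T n α) (t : Icc (0 : ℝ) T), (t : ℝ) = T → σ w ≤ φ (w.upTo t)
  stable : ∀ (p : ACHistInt T n α) (t : Icc (0 : ℝ) T), (p.1.1.t : ℝ) < t →
    ∀ (s : Vec n), ∀ ε > 0, ∃ y ∈ characteristics cH H p.1 0 s,
      φ (y.1.upTo t) - y.2 t ≤ φ p.1 + ε

structure IsLowerSolution {T : ℝ} {n : ℕ} {α : ℝ} (cH : ℝ) (H : ℝ → Vec n → Vec n → ℝ)
    (σ : ACPath T n α → ℝ) (φ : ACHist T n α → ℝ) : Prop where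
  upperSemicontinuous : UpperSemicontinuous φ
  boundary : ∀ (w : ACPath T n α) (t : Icc (0 : ℝ) T), (t : ℝ) = T → φ (w.upTo t) ≤ σ w
  stable : ∀ (p : ACHistInt T n α) (t : Icc (0 : ℝ) T), (p.1.1.t : ℝ) < t →
    ∀ (s : Vec n), ∀ ε > 0, ∃ y ∈ characteristics cH H p.1 0 s,
      φ p.1 - ε ≤ φ (y.1.upTo t) - y.2 t

/-- A minimax solution is an upper and a lower solution. -/
def IsMinimaxSolution {T : ℝ} {n : ℕ} {α : ℝ} (cH : ℝ) (H : ℝ → Vec n → Vec n → ℝ)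
    (σ : ACPath T n α → ℝ) (φ : ACHist T n α → ℝ) : Prop :=
  IsUpperSolution cH H σ φ ∧ IsLowerSolution cH H σ φ

end FracHJ

end

noncomputable section

namespace FracHJ

open Set MeasureTheory

/-! Along a path `x` with Caputo derivative `e` at time `t`, and with `v` the `ci`-gradient of `φ`
there, the Hamilton-Jacobi equation gives `φ(t, x_t) - z(t)` the right derivative `H(t, x, s) - H(t,
x, v) - ⟨s - v, e⟩`. The Lipschitz condition on `H` in its last variable yields an `e` of norm at
most `cH (1 + ‖x(t)‖)` that makes this zero (`exists_velocity`). This `e` need not depend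
continuously on the history, so no existence theorem for ordinary equations is used. Instead `e` is
frozen on short intervals (`exists_continuation`), and compactness removes the errors
(`exists_eq_zero_of_continuation`).

Compactness is sought for the paths alone, in the uniform norm. The function `caputoInt α x = I^(1 -
α)(x - x(0))` depends continuously on `x`, so the growth condition is imposed on its increments and
`z` is written through it (`charValue`); no convergence of derivatives is needed. A fractional
Gronwall inequality and the Hölder estimate for `I^α` give bounds and equicontinuity
(`isCompact_admissible`). The identity `I^(1 - α) I^α = I^1`, a Beta integral, shows that a
Lipschitz `caputoInt α x` puts `x` in `AC^α` (`isAC_of_lipschitzOn`).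

Equality along one characteristic gives both stability inequalities at once. -/

/-- Measurable functions on `[0, T]` that are essentially bounded by `M`. -/
structure BddOn {n : ℕ} (T M : ℝ) (ψ : ℝ → Vec n) : Prop where
  meas : AEStronglyMeasurable ψ (volume.restrict (Icc 0 T))
  bound : ∀ᵐ τ ∂(volume.restrict (Icc 0 T)), ‖ψ τ‖ ≤ M

/-! ### Estimates for fractional integrals -/

theorem one_div_rpow_one_sub {u : ℝ} (hu : 0 ≤ u) (β : ℝ) : 1 / u ^ (1 - β) = u ^ (β - 1) := by
  rw [one_div, ← Real.rpow_neg hu, neg_sub]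

theorem intervalIntegrable_kernel {β : ℝ} (hβ : 0 < β) {τ a b : ℝ} (hab : a ≤ b) (hb : b ≤ τ) :
    IntervalIntegrable (fun ξ => 1 / (τ - ξ) ^ (1 - β)) volume a b := by
  have h := (intervalIntegral.intervalIntegrable_rpow' (a := τ - a) (b := τ - b)
    (show -1 < β - 1 by linarith)).comp_sub_left τ
  simp only [sub_sub_cancel] at h
  refine h.congr fun ξ hξ => ?_
  rw [uIoc_of_le hab] at hξ
  exact (one_div_rpow_one_sub (by linarith [hξ.2]) β).symm

theorem integral_kernel {β : ℝ} (hβ : 0 < β) {τ a b : ℝ} (hab : a ≤ b) (hb : b ≤ τ) :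
    ∫ ξ in a..b, 1 / (τ - ξ) ^ (1 - β) = ((τ - a) ^ β - (τ - b) ^ β) / β := by
  have h : ∫ ξ in a..b, 1 / (τ - ξ) ^ (1 - β) = ∫ ξ in a..b, (fun u => u ^ (β - 1)) (τ - ξ) := by
    refine intervalIntegral.integral_congr fun ξ hξ => ?_
    rw [uIcc_of_le hab] at hξ
    exact one_div_rpow_one_sub (by linarith [hξ.2]) β
  rw [h, intervalIntegral.integral_comp_sub_left (fun u : ℝ => u ^ (β - 1)) τ,
    integral_rpow (Or.inl (by linarith))]
  simp

theorem kernel_nonneg {τ ξ : ℝ} (h : ξ ≤ τ) (β : ℝ) : 0 ≤ 1 / (τ - ξ) ^ (1 - β) :=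
  one_div_nonneg.2 (Real.rpow_nonneg (sub_nonneg.2 h) _)

theorem BddOn.mono {n : ℕ} {T T' M : ℝ} {ψ : ℝ → Vec n} (h : BddOn T M ψ) (hT : T' ≤ T) :
    BddOn T' M ψ :=
  ⟨h.meas.mono_measure (Measure.restrict_mono (Icc_subset_Icc_right hT) le_rfl),
    ae_mono (Measure.restrict_mono (Icc_subset_Icc_right hT) le_rfl) h.bound⟩

theorem BddOn.ae_norm_le {n : ℕ} {T M : ℝ} {ψ : ℝ → Vec n} (h : BddOn T M ψ) {a b : ℝ}
    (ha : 0 ≤ a) (hb : b ≤ T) : ∀ᵐ τ, τ ∈ Ioc a b → ‖ψ τ‖ ≤ M := by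
  filter_upwards [(ae_restrict_iff' measurableSet_Icc).1 h.bound] with τ hτ hm
  exact hτ ⟨ha.trans hm.1.le, hm.2.trans hb⟩

theorem BddOn.meas_Ioc {n : ℕ} {T M : ℝ} {ψ : ℝ → Vec n} (h : BddOn T M ψ) {a b : ℝ}
    (ha : 0 ≤ a) (hb : b ≤ T) : AEStronglyMeasurable ψ (volume.restrict (Ioc a b)) :=
  h.meas.mono_measure (Measure.restrict_mono
    (Ioc_subset_Icc_self.trans (Icc_subset_Icc ha hb)) le_rfl)

theorem BddOn.intervalIntegrable {n : ℕ} {T M : ℝ} {ψ : ℝ → Vec n} (h : BddOn T M ψ) {a b : ℝ}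
    (ha : a ∈ Icc 0 T) (hb : b ∈ Icc 0 T) : IntervalIntegrable ψ volume a b := by
  have key : ∀ {c d : ℝ}, c ∈ Icc 0 T → d ∈ Icc 0 T → IntegrableOn ψ (Ioc c d) := by
    intro c d hc hd
    refine Integrable.of_bound (h.meas_Ioc hc.1 hd.2) M ?_
    exact (ae_restrict_iff' measurableSet_Ioc).2 (h.ae_norm_le hc.1 hd.2)
  exact ⟨key ha hb, key hb ha⟩

theorem BddOn.intervalIntegrable_kernel_smul {n : ℕ} {T M β : ℝ} {ψ : ℝ → Vec n}
    (h : BddOn T M ψ) (hβ : 0 < β) {τ a b : ℝ} (ha : 0 ≤ a) (hab : a ≤ b) (hb : b ≤ τ)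
    (hbT : b ≤ T) :
    IntervalIntegrable (fun ξ => (1 / (τ - ξ) ^ (1 - β)) • ψ ξ) volume a b := by
  rw [intervalIntegrable_iff_integrableOn_Ioc_of_le hab]
  have hk := (intervalIntegrable_iff_integrableOn_Ioc_of_le hab).1
    (intervalIntegrable_kernel hβ hab hb)
  exact Integrable.smul_bdd hk M (h.meas_Ioc ha hbT)
    ((ae_restrict_iff' measurableSet_Ioc).2 (h.ae_norm_le ha hbT))

theorem fracInt_congr_ae {n : ℕ} {β τ : ℝ} {f g : ℝ → Vec n} (hτ : 0 ≤ τ)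
    (h : ∀ᵐ ξ, ξ ∈ Ioc 0 τ → f ξ = g ξ) : fracInt β f τ = fracInt β g τ := by
  unfold fracInt
  congr 1
  refine intervalIntegral.integral_congr_ae ?_
  rw [uIoc_of_le hτ]
  filter_upwards [h] with ξ hξ hm
  rw [hξ hm]

theorem fracInt_congr {n : ℕ} {β τ : ℝ} {f g : ℝ → Vec n} (hτ : 0 ≤ τ)
    (h : ∀ ξ ∈ Ioc 0 τ, f ξ = g ξ) : fracInt β f τ = fracInt β g τ :=
  fracInt_congr_ae hτ (.of_forall h)

theorem fracInt_zero {n : ℕ} (β : ℝ) (ψ : ℝ → Vec n) : fracInt β ψ 0 = 0 := by simp [fracInt]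

/-- The bound `g` may vary with `ξ`: the Gronwall argument takes for it a multiple of `1 + ‖x(ξ)‖`.
-/
theorem norm_fracInt_le_of_norm_le {n : ℕ} {β τ : ℝ} {ψ : ℝ → Vec n} {g : ℝ → ℝ} (hβ : 0 < β)
    (hτ : 0 ≤ τ) (hg : IntervalIntegrable (fun ξ => 1 / (τ - ξ) ^ (1 - β) * g ξ) volume 0 τ)
    (h : ∀ᵐ ξ, ξ ∈ Ioc 0 τ → ‖ψ ξ‖ ≤ g ξ) :
    ‖fracInt β ψ τ‖ ≤ 1 / Real.Gamma β * ∫ ξ in (0 : ℝ)..τ, 1 / (τ - ξ) ^ (1 - β) * g ξ := by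
  have hΓ := Real.Gamma_pos_of_pos hβ
  rw [fracInt, norm_smul, Real.norm_of_nonneg (one_div_nonneg.2 hΓ.le)]
  refine mul_le_mul_of_nonneg_left ?_ (one_div_nonneg.2 hΓ.le)
  refine intervalIntegral.norm_integral_le_of_norm_le hτ ?_ hg
  filter_upwards [h] with ξ hξ hm
  rw [norm_smul, Real.norm_of_nonneg (kernel_nonneg hm.2 β)]
  exact mul_le_mul_of_nonneg_left (hξ hm) (kernel_nonneg hm.2 β)

theorem BddOn.norm_fracInt_le {n : ℕ} {β T M τ : ℝ} {ψ : ℝ → Vec n} (h : BddOn T M ψ)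
    (hβ : 0 < β) (hτ : τ ∈ Icc 0 T) :
    ‖fracInt β ψ τ‖ ≤ 1 / Real.Gamma β * (τ ^ β / β * M) := by
  refine (norm_fracInt_le_of_norm_le hβ hτ.1
    ((intervalIntegrable_kernel hβ hτ.1 le_rfl).mul_const M) (h.ae_norm_le le_rfl hτ.2)).trans ?_
  rw [intervalIntegral.integral_mul_const, integral_kernel hβ hτ.1 le_rfl]
  simp [Real.zero_rpow hβ.ne']

theorem fracInt_sub {n : ℕ} {β T M M' τ : ℝ} {ψ χ : ℝ → Vec n} (h : BddOn T M ψ)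
    (h' : BddOn T M' χ) (hβ : 0 < β) (hτ : τ ∈ Icc 0 T) :
    fracInt β (fun ξ => ψ ξ - χ ξ) τ = fracInt β ψ τ - fracInt β χ τ := by
  simp only [fracInt, smul_sub]
  rw [intervalIntegral.integral_sub
    (h.intervalIntegrable_kernel_smul hβ le_rfl hτ.1 le_rfl hτ.2)
    (h'.intervalIntegrable_kernel_smul hβ le_rfl hτ.1 le_rfl hτ.2), smul_sub]

/-- The fractional integral of a bounded function is Hölder continuous. -/
theorem BddOn.norm_fracInt_sub_le {n : ℕ} {β T M s t : ℝ} {ψ : ℝ → Vec n} (h : BddOn T M ψ)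
    (hM : 0 ≤ M) (hβ : 0 < β) (hβ1 : β ≤ 1) (hs : 0 ≤ s) (hst : s ≤ t) (ht : t ≤ T) :
    ‖fracInt β ψ t - fracInt β ψ s‖ ≤ 1 / Real.Gamma β * (2 * M / β) * (t - s) ^ β := by
  have hΓ := Real.Gamma_pos_of_pos hβ
  have i1 := h.intervalIntegrable_kernel_smul hβ le_rfl hs hst (hst.trans ht)
  have i2 := h.intervalIntegrable_kernel_smul hβ hs hst le_rfl ht
  have i3 := h.intervalIntegrable_kernel_smul hβ le_rfl hs le_rfl (hst.trans ht)
  have j1 := intervalIntegrable_kernel hβ hs hst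
  have j3 := intervalIntegrable_kernel hβ hs le_rfl
  -- On `[0, s]` the difference of the kernels has constant sign, so its absolute value integrates
  -- explicitly.
  have b1 : ‖∫ ξ in (0 : ℝ)..s,
      ((1 / (t - ξ) ^ (1 - β)) • ψ ξ - (1 / (s - ξ) ^ (1 - β)) • ψ ξ)‖ ≤
      ∫ ξ in (0 : ℝ)..s, (1 / (s - ξ) ^ (1 - β) - 1 / (t - ξ) ^ (1 - β)) * M := by
    refine intervalIntegral.norm_integral_le_of_norm_le hs ?_ ((j3.sub j1).mul_const M)
    -- At `ξ = s` the convention `1 / 0 = 0` breaks the comparison of kernels when `β < 1`.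
    have hne : ∀ᵐ ξ : ℝ, ξ ≠ s := by simp [ae_iff, measure_singleton]
    filter_upwards [h.ae_norm_le le_rfl (hst.trans ht), hne] with ξ hξ hne hm
    have hlt : ξ < s := lt_of_le_of_ne hm.2 hne
    have hk : 1 / (t - ξ) ^ (1 - β) ≤ 1 / (s - ξ) ^ (1 - β) := by
      have : 0 < (s - ξ) ^ (1 - β) := Real.rpow_pos_of_pos (by linarith) _
      refine one_div_le_one_div_of_le this ?_
      exact Real.rpow_le_rpow (by linarith) (by linarith) (by linarith)
    rw [← sub_smul, norm_smul, Real.norm_eq_abs, abs_of_nonpos (sub_nonpos.2 hk), neg_sub]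
    exact mul_le_mul_of_nonneg_left (hξ hm) (sub_nonneg.2 hk)
  have b2 : ‖∫ ξ in s..t, (1 / (t - ξ) ^ (1 - β)) • ψ ξ‖ ≤
      ∫ ξ in s..t, 1 / (t - ξ) ^ (1 - β) * M := by
    refine intervalIntegral.norm_integral_le_of_norm_le hst ?_
      ((intervalIntegrable_kernel hβ hst le_rfl).mul_const M)
    filter_upwards [h.ae_norm_le hs ht] with ξ hξ hm
    rw [norm_smul, Real.norm_of_nonneg (kernel_nonneg hm.2 β)]
    exact mul_le_mul_of_nonneg_left (hξ hm) (kernel_nonneg hm.2 β)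
  rw [intervalIntegral.integral_mul_const, intervalIntegral.integral_sub j3 j1,
    integral_kernel hβ hs le_rfl, integral_kernel hβ hs hst] at b1
  rw [intervalIntegral.integral_mul_const, integral_kernel hβ hst le_rfl] at b2
  have e : fracInt β ψ t - fracInt β ψ s = (1 / Real.Gamma β) •
      ((∫ ξ in (0 : ℝ)..s,
        ((1 / (t - ξ) ^ (1 - β)) • ψ ξ - (1 / (s - ξ) ^ (1 - β)) • ψ ξ)) +
        ∫ ξ in s..t, (1 / (t - ξ) ^ (1 - β)) • ψ ξ) := by
    rw [intervalIntegral.integral_sub i1 i3, fracInt, fracInt, ← smul_sub,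
      ← intervalIntegral.integral_add_adjacent_intervals i1 i2]
    congr 1
    abel
  rw [e, norm_smul, Real.norm_of_nonneg (one_div_nonneg.2 hΓ.le), mul_assoc]
  refine mul_le_mul_of_nonneg_left ((norm_add_le _ _).trans ((add_le_add b1 b2).trans ?_))
    (one_div_nonneg.2 hΓ.le)
  have hmono : s ^ β ≤ t ^ β := Real.rpow_le_rpow hs hst hβ.le
  have hM' : 0 ≤ M / β := by positivity
  simp only [sub_zero, sub_self, Real.zero_rpow hβ.ne']
  -- Each of the two intervals contributes one `(t - s) ^ β`, and `s ^ β - t ^ β ≤ 0` is dropped;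
  -- hence the factor 2.
  calc (s ^ β / β - (t ^ β - (t - s) ^ β) / β) * M + (t - s) ^ β / β * M
      = (M / β) * (s ^ β - t ^ β + 2 * (t - s) ^ β) := by ring
    _ ≤ (M / β) * (2 * (t - s) ^ β) := mul_le_mul_of_nonneg_left (by linarith) hM'
    _ = 2 * M / β * (t - s) ^ β := by ring

theorem BddOn.continuousOn_fracInt {n : ℕ} {β T M : ℝ} {ψ : ℝ → Vec n} (h : BddOn T M ψ)
    (hM : 0 ≤ M) (hβ : 0 < β) (hβ1 : β ≤ 1) : ContinuousOn (fracInt β ψ) (Icc 0 T) := by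
  intro t ht
  have key : ∀ s ∈ Icc 0 T, ‖fracInt β ψ s - fracInt β ψ t‖ ≤
      1 / Real.Gamma β * (2 * M / β) * |s - t| ^ β := by
    intro s hs
    rcases le_total s t with hst | hst
    · rw [norm_sub_rev, abs_sub_comm, abs_of_nonneg (sub_nonneg.2 hst)]
      exact h.norm_fracInt_sub_le hM hβ hβ1 hs.1 hst ht.2
    · rw [abs_of_nonneg (sub_nonneg.2 hst)]
      exact h.norm_fracInt_sub_le hM hβ hβ1 ht.1 hst hs.2
  rw [ContinuousWithinAt, tendsto_iff_norm_sub_tendsto_zero]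
  refine squeeze_zero' (.of_forall fun _ => norm_nonneg _)
    (Filter.eventually_of_mem self_mem_nhdsWithin key) ?_
  have : Continuous fun s : ℝ => 1 / Real.Gamma β * (2 * M / β) * |s - t| ^ β :=
    continuous_const.mul ((continuous_abs.comp (continuous_id.sub continuous_const)).rpow_const
      fun _ => Or.inr hβ.le)
  have := this.tendsto t
  simp only [sub_self, abs_zero, Real.zero_rpow hβ.ne', mul_zero] at this
  exact this.mono_left nhdsWithin_le_nhds

/-! ### The semigroup property and the inversion of fractional integrals -/

/-- This is the Beta integral `B(α, 1 - α)`. The power of `t - ξ` produced by scaling has exponent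
`α + (1 - α) - 1 = 0`, so the value is independent of the interval. The complex identity is
transferred by injectivity of `ℝ → ℂ`. -/
theorem integral_rpow_mul_rpow {α : ℝ} (hα : α ∈ Ioo (0 : ℝ) 1) {ξ t : ℝ} (h : ξ < t) :
    ∫ τ in ξ..t, (t - τ) ^ (-α) * (τ - ξ) ^ (α - 1) = Real.Gamma α * Real.Gamma (1 - α) := by
  have ha : 0 < t - ξ := sub_pos.2 h
  have e1 : ∫ τ in ξ..t, (t - τ) ^ (-α) * (τ - ξ) ^ (α - 1) =
      ∫ u in (0 : ℝ)..(t - ξ), u ^ (α - 1) * ((t - ξ) - u) ^ (-α) := by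
    rw [← sub_self ξ, ← intervalIntegral.integral_comp_sub_right
      (fun u => u ^ (α - 1) * ((t - ξ) - u) ^ (-α)) ξ]
    simp only [sub_sub_sub_cancel_right, mul_comm]
  have e2 := Complex.betaIntegral_scaled (α : ℂ) (1 - α : ℂ) ha
  have e3 := Complex.Gamma_mul_Gamma_eq_betaIntegral (s := (α : ℂ)) (t := ((1 - α : ℝ) : ℂ))
    (by simpa using hα.1) (by simpa using hα.2)
  rw [e1]
  apply Complex.ofReal_injective
  rw [← intervalIntegral.integral_ofReal]
  push_cast at e3 ⊢
  rw [← Complex.Gamma_ofReal, ← Complex.Gamma_ofReal]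
  push_cast
  have e4 : (α : ℂ) + (1 - α) = 1 := by ring
  rw [e4, sub_self, Complex.cpow_zero, one_mul] at e2
  rw [e3, e4, Complex.Gamma_one, one_mul, ← e2]
  refine intervalIntegral.integral_congr fun u hu => ?_
  rw [uIcc_of_le ha.le] at hu
  rw [Complex.ofReal_cpow hu.1, Complex.ofReal_cpow (sub_nonneg.2 hu.2)]
  push_cast
  congr 2
  ring

/-- The convolution kernel of the fractional integral of order `β`. -/
def posKernel (β u : ℝ) : ℝ := if 0 < u then u ^ (β - 1) else 0

theorem measurable_posKernel (β : ℝ) : Measurable (posKernel β) :=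
  Measurable.ite measurableSet_Ioi (by fun_prop) measurable_const

theorem posKernel_nonneg (β u : ℝ) : 0 ≤ posKernel β u := by
  unfold posKernel
  split_ifs with h
  · exact Real.rpow_nonneg h.le _
  · exact le_rfl

theorem integral_posKernel_mul {α : ℝ} (hα : α ∈ Ioo (0 : ℝ) 1) {ξ t : ℝ} (hξ : 0 ≤ ξ)
    (h : ξ < t) : ∫ τ in Ioc 0 t, posKernel (1 - α) (t - τ) * posKernel α (τ - ξ) =
      Real.Gamma α * Real.Gamma (1 - α) := by
  rw [← integral_rpow_mul_rpow hα h, intervalIntegral.integral_of_le h.le,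
    integral_Ioc_eq_integral_Ioo, integral_Ioc_eq_integral_Ioo,
    setIntegral_eq_of_subset_of_forall_sdiff_eq_zero measurableSet_Ioo
      (Ioo_subset_Ioo_left hξ) (fun τ hτ => ?_)]
  · refine setIntegral_congr_fun measurableSet_Ioo fun τ hτ => ?_
    simp [posKernel, hτ.1, hτ.2]
  · have : ¬ 0 < τ - ξ := fun h' => hτ.2 ⟨by linarith, hτ.1.2⟩
    simp only [posKernel, this, if_false, mul_zero]

theorem fracInt_eq_posKernel {n : ℕ} {β τ t : ℝ} (ψ : ℝ → Vec n) (hτ : τ ∈ Ioc 0 t) :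
    fracInt β ψ τ = (1 / Real.Gamma β) • ∫ ξ in Ioc 0 t, posKernel β (τ - ξ) • ψ ξ := by
  rw [fracInt, intervalIntegral.integral_of_le hτ.1.le, integral_Ioc_eq_integral_Ioo,
    setIntegral_eq_of_subset_of_forall_sdiff_eq_zero measurableSet_Ioc
      (Ioo_subset_Ioc_self.trans (Ioc_subset_Ioc_right hτ.2)) (fun ξ hξ => ?_)]
  · congr 1
    refine setIntegral_congr_fun measurableSet_Ioo fun ξ hξ => ?_
    have h1 : 0 < τ - ξ := sub_pos.2 hξ.2
    simp only [posKernel, h1, if_true, one_div_rpow_one_sub h1.le]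
  · have : ¬ 0 < τ - ξ := fun h' => hξ.2 ⟨hξ.1.1, by linarith⟩
    simp only [posKernel, this, if_false, zero_smul]

/-- The semigroup property `I^(1 - α) I^α = I^1`. -/
theorem BddOn.fracInt_fracInt {n : ℕ} {α T M t : ℝ} {ψ : ℝ → Vec n} (h : BddOn T M ψ)
    (hα : α ∈ Ioo (0 : ℝ) 1) (ht : t ∈ Icc 0 T) :
    fracInt (1 - α) (fracInt α ψ) t = ∫ τ in (0 : ℝ)..t, ψ τ := by
  rcases ht.1.eq_or_lt with rfl | h0
  · simp [fracInt_zero]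
  have hΓ := (Real.Gamma_pos_of_pos hα.1).ne'
  have hΓ' := (Real.Gamma_pos_of_pos (sub_pos.2 hα.2)).ne'
  set μ : Measure ℝ := volume.restrict (Ioc 0 t) with hμ
  have hψi : Integrable ψ μ := by
    have := h.intervalIntegrable (a := 0) (b := t) ⟨le_rfl, ht.1.trans ht.2⟩ ht
    exact (intervalIntegrable_iff_integrableOn_Ioc_of_le ht.1).1 this
  have hlt : ∀ᵐ ξ ∂μ, 0 ≤ ξ ∧ ξ < t := by
    have hne : ∀ᵐ ξ : ℝ, ξ ≠ t := by simp [ae_iff, measure_singleton]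
    refine (ae_restrict_iff' measurableSet_Ioc).2 ?_
    filter_upwards [hne] with ξ hne hm
    exact ⟨hm.1.le, lt_of_le_of_ne hm.2 hne⟩
  -- Extending the kernels by zero replaces the triangle `ξ < τ < t` by a square, where Fubini
  -- applies to a product measure.
  let F : ℝ → ℝ → Vec n := fun τ ξ => (posKernel (1 - α) (t - τ) * posKernel α (τ - ξ)) • ψ ξ
  have hKm : Measurable fun q : ℝ × ℝ => posKernel (1 - α) (t - q.1) * posKernel α (q.1 - q.2) :=
    ((measurable_posKernel _).comp (by fun_prop)).mul ((measurable_posKernel _).comp (by fun_prop))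
  have hFm : AEStronglyMeasurable (Function.uncurry F) (μ.prod μ) :=
    hKm.aestronglyMeasurable.smul hψi.aestronglyMeasurable.comp_snd
  have hFi : Integrable (Function.uncurry F) (μ.prod μ) := by
    rw [integrable_prod_iff' hFm]
    constructor
    · filter_upwards [hlt] with ξ hξ
      have hi : Integrable (fun τ => posKernel (1 - α) (t - τ) * posKernel α (τ - ξ)) μ := by
        -- A non-integrable function has integral `0` by convention, so the nonzero Beta value
        -- proves integrability.
        refine Integrable.of_integral_ne_zero ?_
        rw [integral_posKernel_mul hα hξ.1 hξ.2]
        exact mul_ne_zero hΓ hΓ'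
      exact hi.smul_const (ψ ξ)
    · refine (hψi.norm.const_mul (Real.Gamma α * Real.Gamma (1 - α))).congr ?_
      filter_upwards [hlt] with ξ hξ
      simp only [Function.uncurry, F, norm_smul, norm_mul,
        Real.norm_of_nonneg (posKernel_nonneg _ _)]
      rw [integral_mul_const, integral_posKernel_mul hα hξ.1 hξ.2]
  have e1 : fracInt (1 - α) (fracInt α ψ) t =
      (1 / Real.Gamma (1 - α)) • (1 / Real.Gamma α) • ∫ τ, ∫ ξ, F τ ξ ∂μ ∂μ := by
    rw [fracInt_eq_posKernel _ ⟨h0, le_rfl⟩]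
    congr 1
    rw [← integral_smul]
    refine setIntegral_congr_fun measurableSet_Ioc fun τ hτ => ?_
    simp only [F, mul_smul]
    rw [fracInt_eq_posKernel ψ hτ, integral_smul, smul_comm]
  have e2 : ∫ ξ, ∫ τ, F τ ξ ∂μ ∂μ = (Real.Gamma α * Real.Gamma (1 - α)) • ∫ ξ, ψ ξ ∂μ := by
    rw [← integral_smul]
    refine integral_congr_ae ?_
    filter_upwards [hlt] with ξ hξ
    rw [integral_smul_const, integral_posKernel_mul hα hξ.1 hξ.2]
  rw [e1, integral_integral_swap hFi, e2, intervalIntegral.integral_of_le ht.1, smul_smul,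
    smul_smul]
  field_simp
  simp [hμ]

/-- A bounded function whose fractional integral of order `1 - α` has a bounded density `ψ` is
the fractional integral of order `α` of `ψ`. -/
theorem eq_fracInt_of_fracInt_eq_integral {n : ℕ} {α T M : ℝ} {f ψ : ℝ → Vec n}
    (hα : α ∈ Ioo (0 : ℝ) 1) (hM : 0 ≤ M) (hf : ContinuousOn f (Icc 0 T)) (hψ : BddOn T M ψ)
    (h : ∀ t ∈ Icc 0 T, fracInt (1 - α) f t = ∫ τ in (0 : ℝ)..t, ψ τ) (hT : 0 < T)
    {t : ℝ} (ht : t ∈ Icc 0 T) : f t = fracInt α ψ t := by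
  have hg := hψ.continuousOn_fracInt hM hα.1 hα.2.le
  obtain ⟨C, hC⟩ := isCompact_Icc.exists_bound_of_continuousOn hf
  obtain ⟨C', hC'⟩ := isCompact_Icc.exists_bound_of_continuousOn hg
  have bf : BddOn T C f := ⟨hf.aestronglyMeasurable measurableSet_Icc,
    (ae_restrict_iff' measurableSet_Icc).2 (.of_forall hC)⟩
  have bg : BddOn T C' (fracInt α ψ) := ⟨hg.aestronglyMeasurable measurableSet_Icc,
    (ae_restrict_iff' measurableSet_Icc).2 (.of_forall hC')⟩
  have hd : ContinuousOn (fun τ => f τ - fracInt α ψ τ) (Icc 0 T) := hf.sub hg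
  have bd : BddOn T (C + C') (fun τ => f τ - fracInt α ψ τ) :=
    ⟨hd.aestronglyMeasurable measurableSet_Icc, (ae_restrict_iff' measurableSet_Icc).2
      (.of_forall fun τ hτ => (norm_sub_le _ _).trans (add_le_add (hC τ hτ) (hC' τ hτ)))⟩
  have hα' : 1 - α ∈ Ioo (0 : ℝ) 1 := ⟨by linarith [hα.2], by linarith [hα.1]⟩
  -- The semigroup property with `1 - α` in place of `α`: the difference `d` satisfies `I^(1 - α) d
  -- = 0`, hence `I^1 d = I^α I^(1 - α) d = 0`, and a continuous function with vanishing primitive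
  -- is zero.
  have hz : ∀ s ∈ Icc 0 T, ∫ τ in (0 : ℝ)..s, (f τ - fracInt α ψ τ) = 0 := by
    intro s hs
    rw [← bd.fracInt_fracInt hα' hs,
      fracInt_congr (g := fun _ => 0) hs.1 fun ξ hξ => ?_]
    · simp [fracInt]
    · have hξ' : ξ ∈ Icc 0 T := ⟨hξ.1.le, hξ.2.trans hs.2⟩
      rw [fracInt_sub bf bg hα'.1 hξ', h ξ hξ', hψ.fracInt_fracInt hα hξ', sub_self]
  have hin : EqOn (fun τ => f τ - fracInt α ψ τ) (fun _ => 0) (Ioo 0 T) := by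
    intro s hs
    have hs' : s ∈ Icc 0 T := Ioo_subset_Icc_self hs
    have hn : Icc 0 T ∈ nhds s := Icc_mem_nhds hs.1 hs.2
    have h1 := intervalIntegral.integral_hasDerivAt_right
      (bd.intervalIntegrable ⟨le_rfl, hT.le⟩ hs')
      ⟨Icc 0 T, hn, bd.meas⟩ (hd.continuousAt hn)
    have h2 : HasDerivAt (fun u => ∫ τ in (0 : ℝ)..u, (f τ - fracInt α ψ τ)) 0 s :=
      (hasDerivAt_const s (0 : Vec n)).congr_of_eventuallyEq
        (Filter.eventually_of_mem hn hz)
    exact h1.unique h2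
  have hcl : Icc 0 T ⊆ closure (Ioo 0 T) := by rw [closure_Ioo hT.ne]
  exact sub_eq_zero.1 (hin.of_subset_closure hd continuousOn_const Ioo_subset_Icc_self hcl ht)

/-! ### Lipschitz functions as primitives of their derivatives -/

theorem ae_differentiableAt_of_lipschitzOn {n : ℕ} {f : ℝ → Vec n} {T : ℝ} {K : NNReal}
    (hf : LipschitzOnWith K f (Icc 0 T)) : ∀ᵐ t, t ∈ Ioo 0 T → DifferentiableAt ℝ f t := by
  filter_upwards [hf.ae_differentiableWithinAt_of_mem_real] with t ht hm
  exact (ht (Ioo_subset_Icc_self hm)).differentiableAt (Icc_mem_nhds hm.1 hm.2)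

theorem bddOn_deriv_of_lipschitzOn {n : ℕ} {f : ℝ → Vec n} {T : ℝ} {K : NNReal}
    (hf : LipschitzOnWith K f (Icc 0 T)) : BddOn T K (deriv f) := by
  refine ⟨(measurable_deriv f).aestronglyMeasurable, ?_⟩
  rw [← restrict_Ioo_eq_restrict_Icc]
  refine (ae_restrict_iff' measurableSet_Ioo).2 (.of_forall fun t ht => ?_)
  exact norm_deriv_le_of_lipschitzOn (Icc_mem_nhds ht.1 ht.2) hf

/-- Pairing with `v` reduces to a scalar Lipschitz function, which is absolutely continuous and so
equals the integral of its derivative. -/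
theorem integral_inner_deriv_of_lipschitzOn {n : ℕ} {f : ℝ → Vec n} {T a b : ℝ} {K : NNReal}
    (hf : LipschitzOnWith K f (Icc 0 T)) (ha : a ∈ Icc 0 T) (hb : b ∈ Icc 0 T) (hab : a ≤ b)
    (v : Vec n) : ∫ t in a..b, inner ℝ v (deriv f t) = inner ℝ v (f b - f a) := by
  have hsub : uIcc a b ⊆ Icc 0 T := by
    rw [uIcc_of_le hab]
    exact Icc_subset_Icc ha.1 hb.2
  have hL : LipschitzOnWith (‖innerSL ℝ v‖₊ * K) (fun t => inner ℝ v (f t)) (uIcc a b) :=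
    (innerSL ℝ v).lipschitz.comp_lipschitzOnWith (hf.mono hsub)
  rw [inner_sub_right, ← hL.absolutelyContinuousOnInterval.integral_deriv_eq_sub]
  refine intervalIntegral.integral_congr_ae ?_
  rw [uIoc_of_le hab]
  have hne : ∀ᵐ ξ : ℝ, ξ ≠ T := by simp [ae_iff, measure_singleton]
  filter_upwards [ae_differentiableAt_of_lipschitzOn hf, hne] with t ht hne hm
  have hd := ht ⟨ha.1.trans_lt hm.1, lt_of_le_of_ne (hm.2.trans hb.2) hne⟩
  exact (((innerSL ℝ v).hasFDerivAt.comp_hasDerivAt t hd.hasDerivAt).deriv).symm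

theorem integral_deriv_of_lipschitzOn {n : ℕ} {f : ℝ → Vec n} {T a b : ℝ} {K : NNReal}
    (hf : LipschitzOnWith K f (Icc 0 T)) (ha : a ∈ Icc 0 T) (hb : b ∈ Icc 0 T) (hab : a ≤ b) :
    ∫ t in a..b, deriv f t = f b - f a := by
  refine ext_inner_left ℝ fun v => ?_
  rw [← integral_inner_deriv_of_lipschitzOn hf ha hb hab v, intervalIntegral.integral_of_le hab,
    intervalIntegral.integral_of_le hab, integral_inner]
  exact (intervalIntegrable_iff_integrableOn_Ioc_of_le hab).1
    ((bddOn_deriv_of_lipschitzOn hf).intervalIntegrable ha hb)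

/-! ### A fractional Gronwall inequality -/

/-- The substitution `u = t - τ` extracts `exp (l * t)` and leaves a truncated Gamma integral,
bounded by the full one. -/
theorem integral_kernel_mul_exp_le {α l t : ℝ} (hα : 0 < α) (hl : 0 < l) (ht : 0 ≤ t) :
    ∫ τ in (0 : ℝ)..t, 1 / (t - τ) ^ (1 - α) * Real.exp (l * τ) ≤
      Real.exp (l * t) * ((1 / l) ^ α * Real.Gamma α) := by
  have hi : IntegrableOn (fun u : ℝ => u ^ (α - 1) * Real.exp (-(l * u))) (Ioi 0) := by
    refine Integrable.of_integral_ne_zero ?_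
    rw [Real.integral_rpow_mul_exp_neg_mul_Ioi hα hl]
    have := Real.Gamma_pos_of_pos hα
    positivity
  have e : ∫ τ in (0 : ℝ)..t, 1 / (t - τ) ^ (1 - α) * Real.exp (l * τ) =
      ∫ τ in (0 : ℝ)..t, (fun u : ℝ => Real.exp (l * t) * (u ^ (α - 1) * Real.exp (-(l * u))))
        (t - τ) := by
    refine intervalIntegral.integral_congr fun τ hτ => ?_
    rw [uIcc_of_le ht] at hτ
    simp only
    rw [one_div_rpow_one_sub (sub_nonneg.2 hτ.2), mul_left_comm, ← Real.exp_add]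
    congr 2
    ring
  rw [e, intervalIntegral.integral_comp_sub_left
    (fun u : ℝ => Real.exp (l * t) * (u ^ (α - 1) * Real.exp (-(l * u)))),
    intervalIntegral.integral_const_mul, sub_self, sub_zero,
    ← Real.integral_rpow_mul_exp_neg_mul_Ioi hα hl, intervalIntegral.integral_of_le ht]
  refine mul_le_mul_of_nonneg_left ?_ (Real.exp_pos _).le
  refine setIntegral_mono_set hi ?_ Ioc_subset_Ioi_self.eventuallyLE
  refine (ae_restrict_iff' measurableSet_Ioi).2 (.of_forall fun u hu => ?_)
  exact mul_nonneg (Real.rpow_nonneg (le_of_lt hu) _) (Real.exp_pos _).le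

/-- A Gronwall inequality for fractional integrals: the bound `B` only depends on the data. -/
theorem exists_bound_of_le_fracInt {α c : ℝ} (hα : 0 < α) (hc : 0 ≤ c) (T A : ℝ) (hA : 0 ≤ A) :
    ∃ B : ℝ, ∀ g : ℝ → ℝ, ContinuousOn g (Icc 0 T) → (∀ t ∈ Icc 0 T, 0 ≤ g t) →
      (∀ t ∈ Icc 0 T, g t ≤ A + 1 / Real.Gamma α *
        ∫ τ in (0 : ℝ)..t, 1 / (t - τ) ^ (1 - α) * (c * g τ)) → ∀ t ∈ Icc 0 T, g t ≤ B := by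
  -- For this `l` the integral term costs at most half of the weighted norm `sup exp (-l τ) g(τ)`.
  obtain ⟨l, hl, hcl⟩ : ∃ l : ℝ, 0 < l ∧ c * (1 / l) ^ α ≤ 1 / 2 := by
    have h1 : Filter.Tendsto (fun l : ℝ => c * (1 / l) ^ α) Filter.atTop (nhds (c * 0)) := by
      refine Filter.Tendsto.const_mul c ?_
      have := tendsto_rpow_neg_atTop hα
      refine this.congr' ?_
      filter_upwards [Filter.eventually_gt_atTop 0] with l hl
      rw [Real.rpow_neg hl.le, one_div, Real.inv_rpow hl.le]
    rw [mul_zero] at h1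
    obtain ⟨l, h⟩ := ((h1.eventually (gt_mem_nhds (show (0 : ℝ) < 1 / 2 by norm_num))).and
      (Filter.eventually_gt_atTop 0)).exists
    exact ⟨l, h.2, h.1.le⟩
  refine ⟨2 * A * Real.exp (l * T), fun g hg hg0 h t ht => ?_⟩
  have hΓ := Real.Gamma_pos_of_pos hα
  have hcont : ContinuousOn (fun τ => Real.exp (-(l * τ)) * g τ) (Icc 0 T) :=
    (by fun_prop : Continuous fun τ : ℝ => Real.exp (-(l * τ))).continuousOn.mul hg
  obtain ⟨m, hm, hmax⟩ := isCompact_Icc.exists_isMaxOn ⟨t, ht⟩ hcont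
  set N := Real.exp (-(l * m)) * g m with hN
  have hN0 : 0 ≤ N := mul_nonneg (Real.exp_pos _).le (hg0 m hm)
  have hgN : ∀ τ ∈ Icc 0 T, g τ ≤ N * Real.exp (l * τ) := by
    intro τ hτ
    have h1 : Real.exp (-(l * τ)) * g τ ≤ N := hmax hτ
    calc g τ = (Real.exp (-(l * τ)) * g τ) * Real.exp (l * τ) := by
          rw [mul_right_comm, ← Real.exp_add, neg_add_cancel, Real.exp_zero, one_mul]
      _ ≤ _ := mul_le_mul_of_nonneg_right h1 (Real.exp_pos _).le
  have hk := intervalIntegrable_kernel hα hm.1 le_rfl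
  have hint : ∫ τ in (0 : ℝ)..m, 1 / (m - τ) ^ (1 - α) * (c * g τ) ≤
      ∫ τ in (0 : ℝ)..m, 1 / (m - τ) ^ (1 - α) * Real.exp (l * τ) * (c * N) := by
    have hsub : uIcc 0 m ⊆ Icc 0 T := by
      rw [uIcc_of_le hm.1]
      exact Icc_subset_Icc_right hm.2
    refine intervalIntegral.integral_mono_on hm.1
      (hk.mul_continuousOn (continuousOn_const.mul (hg.mono hsub)))
      ((hk.mul_continuousOn (by fun_prop)).mul_const _) fun τ hτ => ?_
    rw [mul_assoc]
    refine mul_le_mul_of_nonneg_left ?_ (kernel_nonneg hτ.2 α)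
    have := mul_le_mul_of_nonneg_left (hgN τ ⟨hτ.1, hτ.2.trans hm.2⟩) hc
    linarith
  rw [intervalIntegral.integral_mul_const] at hint
  have hE := integral_kernel_mul_exp_le hα hl hm.1
  have h2 : g m ≤ A + Real.exp (l * m) * (N / 2) := by
    refine (h m hm).trans (add_le_add_right ?_ A)
    calc 1 / Real.Gamma α * ∫ τ in (0 : ℝ)..m, 1 / (m - τ) ^ (1 - α) * (c * g τ)
        ≤ 1 / Real.Gamma α * (Real.exp (l * m) * ((1 / l) ^ α * Real.Gamma α) * (c * N)) := by
          refine mul_le_mul_of_nonneg_left (hint.trans ?_) (one_div_nonneg.2 hΓ.le)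
          exact mul_le_mul_of_nonneg_right hE (mul_nonneg hc hN0)
      _ = Real.exp (l * m) * (N * (c * (1 / l) ^ α)) := by
          field_simp
      _ ≤ Real.exp (l * m) * (N * (1 / 2)) := by
          gcongr
      _ = _ := by ring
  -- The half is absorbed: `N ≤ 2 A`, whence the bound `2 A exp (l T)`.
  have h3 : N ≤ A + N / 2 := by
    have h4 : Real.exp (-(l * m)) ≤ 1 := Real.exp_le_one_iff.2 (by nlinarith [hm.1])
    calc N ≤ Real.exp (-(l * m)) * (A + Real.exp (l * m) * (N / 2)) :=
          mul_le_mul_of_nonneg_left h2 (Real.exp_pos _).le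
      _ = Real.exp (-(l * m)) * A + N / 2 := by
          rw [mul_add, ← mul_assoc, ← Real.exp_add, neg_add_cancel, Real.exp_zero, one_mul]
      _ ≤ A + N / 2 := by nlinarith
  calc g t ≤ N * Real.exp (l * t) := hgN t ht
    _ ≤ 2 * A * Real.exp (l * T) := by
      have : l * t ≤ l * T := mul_le_mul_of_nonneg_left ht.2 hl.le
      gcongr
      linarith

/-! ### Paths of class `AC^α` through `caputoInt` -/

theorem ext_of_mem {t τ : ℝ} {F : Type} [Zero F] (x : Icc (0 : ℝ) t → F) (hτ : τ ∈ Icc 0 t) :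
    ext x τ = x ⟨τ, hτ⟩ :=
  Subtype.val_injective.extend_apply x 0 ⟨τ, hτ⟩

theorem continuousOn_ext {t : ℝ} {n : ℕ} (x : C(Icc (0 : ℝ) t, Vec n)) :
    ContinuousOn (ext x) (Icc 0 t) := by
  rw [continuousOn_iff_continuous_domRestrict]
  refine x.continuous.congr fun τ => ?_
  exact (ext_of_mem x τ.2).symm

/-- The fractional integral of order `1 - α` of `x(·) - x(0)`, whose derivative is the Caputo
derivative of `x`. -/
def caputoInt {n : ℕ} (α : ℝ) {t : ℝ} (x : C(Icc (0 : ℝ) t, Vec n)) : ℝ → Vec n :=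
  fracInt (1 - α) fun ξ => ext x ξ - ext x 0

theorem caputo_eq_deriv {n : ℕ} (α : ℝ) {t : ℝ} (x : C(Icc (0 : ℝ) t, Vec n)) :
    caputo α x = deriv (caputoInt α x) := rfl

theorem caputoInt_congr {n : ℕ} {α t t' τ : ℝ} {x : C(Icc (0 : ℝ) t, Vec n)}
    {x' : C(Icc (0 : ℝ) t', Vec n)} (hτ : 0 ≤ τ) (h : ∀ ξ ∈ Icc 0 τ, ext x ξ = ext x' ξ) :
    caputoInt α x τ = caputoInt α x' τ :=
  fracInt_congr hτ fun ξ hξ => by rw [h ξ ⟨hξ.1.le, hξ.2⟩, h 0 ⟨le_rfl, hτ⟩]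

theorem exists_bddOn_of_memLp {n : ℕ} {t : ℝ} {ψ : ℝ → Vec n}
    (h : MemLp ψ ⊤ (volume.restrict (Icc 0 t))) : ∃ M, 0 ≤ M ∧ BddOn t M ψ := by
  refine ⟨(eLpNormEssSup ψ (volume.restrict (Icc 0 t))).toReal, ENNReal.toReal_nonneg, h.1, ?_⟩
  have h2 := h.2
  rw [eLpNorm_exponent_top] at h2
  filter_upwards [ae_le_eLpNormEssSup (f := ψ) (μ := volume.restrict (Icc 0 t))] with τ hτ
  rw [← toReal_enorm]
  exact ENNReal.toReal_mono h2.ne hτ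

theorem BddOn.memLp {n : ℕ} {t M : ℝ} {ψ : ℝ → Vec n} (h : BddOn t M ψ) :
    MemLp ψ ⊤ (volume.restrict (Icc 0 t)) :=
  memLp_top_of_bound h.meas M h.bound

theorem BddOn.caputoInt_eq {n : ℕ} {α T M τ : ℝ} {ψ : ℝ → Vec n} {x : C(Icc (0 : ℝ) T, Vec n)}
    {x₀ : Vec n} (hψ : BddOn T M ψ) (hα : α ∈ Ioo (0 : ℝ) 1)
    (h : ∀ ξ ∈ Icc 0 T, ext x ξ = x₀ + fracInt α ψ ξ) (hτ : τ ∈ Icc 0 T) :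
    caputoInt α x τ = ∫ ξ in (0 : ℝ)..τ, ψ ξ := by
  rw [← hψ.fracInt_fracInt hα hτ]
  refine fracInt_congr hτ.1 fun ξ hξ => ?_
  rw [h ξ ⟨hξ.1.le, hξ.2.trans hτ.2⟩, h 0 ⟨le_rfl, hτ.1.trans hτ.2⟩, fracInt_zero]
  simp

/-- By the semigroup property `caputoInt α x` is the primitive of the bounded density of `x`. The
converse is `isAC_of_lipschitzOn`. -/
theorem IsAC.exists_lipschitzOn {n : ℕ} {α t : ℝ} (hα : α ∈ Ioo (0 : ℝ) 1)
    {x : C(Icc (0 : ℝ) t, Vec n)} (hx : IsAC α x) :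
    ∃ K, LipschitzOnWith K (caputoInt α x) (Icc 0 t) := by
  obtain ⟨ψ, hψ, h⟩ := hx
  obtain ⟨M, hM, hb⟩ := exists_bddOn_of_memLp hψ
  have he : ∀ ξ ∈ Icc 0 t, ext x ξ = ext x 0 + fracInt α ψ ξ := fun ξ hξ => by
    rw [ext_of_mem x hξ, ext_of_mem x ⟨le_rfl, hξ.1.trans hξ.2⟩]
    exact h ⟨ξ, hξ⟩
  have hc := fun τ hτ => hb.caputoInt_eq (τ := τ) hα he hτ
  refine ⟨⟨M, hM⟩, LipschitzOnWith.of_dist_le_mul fun a ha b hb' => ?_⟩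
  have h0 : (0 : ℝ) ∈ Icc 0 t := ⟨le_rfl, ha.1.trans ha.2⟩
  rw [dist_eq_norm, hc a ha, hc b hb', intervalIntegral.integral_interval_sub_left
    (hb.intervalIntegrable h0 ha) (hb.intervalIntegrable h0 hb'), Real.dist_eq]
  refine intervalIntegral.norm_integral_le_of_norm_le_const_ae ?_
  exact hb.ae_norm_le (le_min hb'.1 ha.1) (max_le hb'.2 ha.2)

/-- The derivative of the Lipschitz function `caputoInt α x` is bounded and is its density;
inverting `I^(1 - α)` shows that it is also the density of `x`. -/
theorem ext_eq_of_lipschitzOn {n : ℕ} {α T τ : ℝ} (hT : 0 < T) (hα : α ∈ Ioo (0 : ℝ) 1)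
    {x : C(Icc (0 : ℝ) T, Vec n)} {K : NNReal}
    (hx : LipschitzOnWith K (caputoInt α x) (Icc 0 T)) (hτ : τ ∈ Icc 0 T) :
    ext x τ = ext x 0 + fracInt α (caputo α x) τ := by
  rw [← sub_eq_iff_eq_add']
  refine eq_fracInt_of_fracInt_eq_integral (f := fun ξ => ext x ξ - ext x 0) hα K.2
    ((continuousOn_ext x).sub continuousOn_const) (bddOn_deriv_of_lipschitzOn hx)
    (fun t ht => ?_) hT hτ
  rw [integral_deriv_of_lipschitzOn hx ⟨le_rfl, hT.le⟩ ht ht.1]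
  simp [caputoInt, fracInt_zero]

theorem isAC_of_lipschitzOn {n : ℕ} {α T : ℝ} (hT : 0 < T) (hα : α ∈ Ioo (0 : ℝ) 1)
    {x : C(Icc (0 : ℝ) T, Vec n)} {K : NNReal}
    (hx : LipschitzOnWith K (caputoInt α x) (Icc 0 T)) : IsAC α x := by
  refine ⟨caputo α x, (bddOn_deriv_of_lipschitzOn hx).memLp, fun τ => ?_⟩
  have := ext_eq_of_lipschitzOn hT hα hx τ.2
  rwa [ext_of_mem x τ.2, ext_of_mem x ⟨le_rfl, hT.le⟩] at this

theorem BddOn.exists_path {n : ℕ} {α T M : ℝ} {ψ : ℝ → Vec n} (hψ : BddOn T M ψ) (hM : 0 ≤ M)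
    (hα : α ∈ Ioo (0 : ℝ) 1) (x₀ : Vec n) : ∃ x : C(Icc (0 : ℝ) T, Vec n),
      ∀ ξ ∈ Icc 0 T, ext x ξ = x₀ + fracInt α ψ ξ := by
  have hc : ContinuousOn (fun ξ => x₀ + fracInt α ψ ξ) (Icc 0 T) :=
    continuousOn_const.add (hψ.continuousOn_fracInt hM hα.1 hα.2.le)
  refine ⟨⟨fun τ : Icc (0 : ℝ) T => x₀ + fracInt α ψ τ, hc.domRestrict⟩, fun ξ hξ => ?_⟩
  rw [ext_of_mem _ hξ]
  rfl

theorem norm_ext_sub_le {n : ℕ} {T τ : ℝ} (x x' : C(Icc (0 : ℝ) T, Vec n)) :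
    ‖ext x τ - ext x' τ‖ ≤ dist x x' := by
  by_cases hτ : τ ∈ Icc 0 T
  · rw [ext_of_mem x hτ, ext_of_mem x' hτ, ← dist_eq_norm]
    exact ContinuousMap.dist_apply_le_dist _
  · have h : ¬ ∃ a : Icc (0 : ℝ) T, (a : ℝ) = τ := fun ⟨a, ha⟩ => hτ (ha ▸ a.2)
    simp [ext, Function.extend_apply' _ _ _ h]

theorem bddOn_ext_sub {n : ℕ} {T : ℝ} (x : C(Icc (0 : ℝ) T, Vec n)) :
    ∃ M, BddOn T M fun ξ => ext x ξ - ext x 0 := by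
  have hc : ContinuousOn (fun ξ => ext x ξ - ext x 0) (Icc 0 T) :=
    (continuousOn_ext x).sub continuousOn_const
  obtain ⟨C, hC⟩ := isCompact_Icc.exists_bound_of_continuousOn hc
  exact ⟨C, hc.aestronglyMeasurable measurableSet_Icc,
    (ae_restrict_iff' measurableSet_Icc).2 (.of_forall hC)⟩

/-- `I^(1 - α)` is bounded for the uniform norm, and subtracting `x(0)` accounts for the factor 2.
This is what lets the constraints and `z` pass to uniform limits. -/
theorem continuous_caputoInt {n : ℕ} {α T τ : ℝ} (hα : α ∈ Ioo (0 : ℝ) 1) (hτ : τ ∈ Icc 0 T) :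
    Continuous fun x : C(Icc (0 : ℝ) T, Vec n) => caputoInt α x τ := by
  have hβ : 0 < 1 - α := sub_pos.2 hα.2
  have hΓ := Real.Gamma_pos_of_pos hβ
  have hC : 0 ≤ 1 / Real.Gamma (1 - α) * (τ ^ (1 - α) / (1 - α) * 2) := by
    have := Real.rpow_nonneg hτ.1 (1 - α)
    positivity
  refine (LipschitzWith.of_dist_le_mul (K := ⟨_, hC⟩) fun x x' => ?_).continuous
  obtain ⟨M, hM⟩ := bddOn_ext_sub x
  obtain ⟨M', hM'⟩ := bddOn_ext_sub x'
  have hb : BddOn T (2 * dist x x')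
      fun ξ => (ext x ξ - ext x 0) - (ext x' ξ - ext x' 0) := by
    refine ⟨hM.meas.sub hM'.meas, .of_forall fun ξ => ?_⟩
    rw [sub_sub_sub_comm, two_mul]
    exact (norm_sub_le _ _).trans (add_le_add (norm_ext_sub_le x x') (norm_ext_sub_le x x'))
  rw [dist_eq_norm, caputoInt, caputoInt, ← fracInt_sub hM hM' hβ hτ]
  refine (hb.norm_fracInt_le hβ hτ).trans (le_of_eq ?_)
  change _ = 1 / Real.Gamma (1 - α) * (τ ^ (1 - α) / (1 - α) * 2) * dist x x'
  ring

/-! ### The compact set of admissible paths -/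

/-- The continuous extensions of the path `w₀`, where `p = (t₀, w₀)`, whose Caputo derivative `v`
satisfies `‖v(t)‖ ≤ c (1 + ‖x(t)‖)` for `t > t₀`; the bound is stated in its integral form, which is
preserved by uniform convergence. -/
def admissible {T : ℝ} {n : ℕ} {α : ℝ} (c : ℝ) (p : ACHist T n α) :
    Set C(Icc (0 : ℝ) T, Vec n) :=
  {x | (∀ τ ∈ Icc 0 (p.1.t : ℝ), ext x τ = ext p.1.w τ) ∧
    ∀ a b, (p.1.t : ℝ) ≤ a → a ≤ b → b ≤ T →
      ‖caputoInt α x b - caputoInt α x a‖ ≤ ∫ τ in a..b, c * (1 + ‖ext x τ‖)}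

theorem continuousOn_growth {T : ℝ} {n : ℕ} (c : ℝ) (x : C(Icc (0 : ℝ) T, Vec n)) :
    ContinuousOn (fun τ => c * (1 + ‖ext x τ‖)) (Icc 0 T) :=
  continuousOn_const.mul (continuousOn_const.add (continuousOn_ext x).norm)

theorem intervalIntegrable_growth {T : ℝ} {n : ℕ} (c : ℝ) (x : C(Icc (0 : ℝ) T, Vec n)) {a b : ℝ}
    (ha : a ∈ Icc 0 T) (hb : b ∈ Icc 0 T) :
    IntervalIntegrable (fun τ => c * (1 + ‖ext x τ‖)) volume a b :=
  ((continuousOn_growth c x).mono (uIcc_subset_Icc ha hb)).intervalIntegrable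

/-- Divide the increment bound by the length of the interval and use continuity of `c (1 + ‖x‖)` at
`t`. The estimate holds at every `t`, since `deriv` is zero where `caputoInt α x` is not
differentiable. -/
theorem caputo_norm_le_of_mem {T : ℝ} {n : ℕ} {α c : ℝ} (hc : 0 ≤ c) {p : ACHist T n α}
    {x : C(Icc (0 : ℝ) T, Vec n)} (hx : x ∈ admissible c p) {t : ℝ} (ht : t ∈ Ioo (p.1.t : ℝ) T) :
    ‖caputo α x t‖ ≤ c * (1 + ‖ext x t‖) := by
  have ht0 : 0 < t := p.1.t.2.1.trans_lt ht.1
  refine le_of_forall_pos_le_add fun ε hε => ?_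
  have hn : Icc 0 T ∈ nhds t := Icc_mem_nhds ht0 ht.2
  have hcont := (continuousOn_growth c x).continuousAt hn
  have hev : ∀ᶠ τ in nhds t, τ ∈ Ioo (p.1.t : ℝ) T ∧
      c * (1 + ‖ext x τ‖) < c * (1 + ‖ext x t‖) + ε :=
    Filter.Eventually.and (Ioo_mem_nhds ht.1 ht.2)
      (hcont.eventually (gt_mem_nhds (by linarith)))
  obtain ⟨r, hr, hball⟩ := Metric.eventually_nhds_iff_ball.1 hev
  have key : ∀ a b, a ∈ Metric.ball t r → b ∈ Metric.ball t r → a ≤ b →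
      ‖caputoInt α x b - caputoInt α x a‖ ≤ (c * (1 + ‖ext x t‖) + ε) * (b - a) := by
    intro a b ha hb hab
    have ha' := (hball a ha).1
    have hb' := (hball b hb).1
    refine (hx.2 a b ha'.1.le hab hb'.2.le).trans ?_
    have h1 : ∫ τ in a..b, c * (1 + ‖ext x τ‖) ≤ ∫ τ in a..b, (c * (1 + ‖ext x t‖) + ε) := by
      refine intervalIntegral.integral_mono_on hab
        (intervalIntegrable_growth c x ⟨p.1.t.2.1.trans ha'.1.le, ha'.2.le⟩
          ⟨p.1.t.2.1.trans hb'.1.le, hb'.2.le⟩) intervalIntegrable_const fun τ hτ => ?_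
      rw [Real.ball_eq_Ioo] at ha hb hball
      exact (hball τ ⟨ha.1.trans_le hτ.1, hτ.2.trans_lt hb.2⟩).2.le
    rw [intervalIntegral.integral_const, smul_eq_mul, mul_comm] at h1
    exact h1
  rw [caputo_eq_deriv]
  refine norm_deriv_le_of_lip' (by positivity) ?_
  filter_upwards [Metric.ball_mem_nhds t hr] with τ hτ
  have htt : t ∈ Metric.ball t r := Metric.mem_ball_self hr
  rcases le_total τ t with h | h
  · rw [norm_sub_rev, norm_sub_rev τ, Real.norm_of_nonneg (sub_nonneg.2 h)]
    exact key τ t hτ htt h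
  · rw [Real.norm_of_nonneg (sub_nonneg.2 h)]
    exact key t τ htt hτ h

/-- `w₀` controls the increments before `t₀` and the growth condition those after it; the sum of the
constants covers intervals containing `t₀`. The constant depends on `x` only through `B`, as
equicontinuity requires. -/
theorem lipschitzOn_of_mem {T : ℝ} {n : ℕ} {α c : ℝ} (hc : 0 ≤ c) {p : ACHist T n α} {K : NNReal}
    (hK : LipschitzOnWith K (caputoInt α p.1.w) (Icc 0 (p.1.t : ℝ)))
    {x : C(Icc (0 : ℝ) T, Vec n)} (hx : x ∈ admissible c p) {B : ℝ} (hB : 0 ≤ B)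
    (hxB : ∀ τ ∈ Icc 0 T, ‖ext x τ‖ ≤ B) :
    LipschitzOnWith (K + ⟨c * (1 + B), by positivity⟩) (caputoInt α x) (Icc 0 T) := by
  have hL : 0 ≤ c * (1 + B) := by positivity
  have h1 : ∀ a b, 0 ≤ a → a ≤ b → b ≤ (p.1.t : ℝ) →
      ‖caputoInt α x b - caputoInt α x a‖ ≤ K * (b - a) := by
    intro a b ha hab hb
    have he : ∀ τ ∈ Icc 0 (p.1.t : ℝ), caputoInt α x τ = caputoInt α p.1.w τ := fun τ hτ =>
      caputoInt_congr hτ.1 fun ξ hξ => hx.1 ξ ⟨hξ.1, hξ.2.trans hτ.2⟩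
    have := hK.dist_le_mul b ⟨ha.trans hab, hb⟩ a ⟨ha, hab.trans hb⟩
    rwa [dist_eq_norm, Real.dist_eq, abs_of_nonneg (sub_nonneg.2 hab),
      ← he b ⟨ha.trans hab, hb⟩, ← he a ⟨ha, hab.trans hb⟩] at this
  have h2 : ∀ a b, (p.1.t : ℝ) ≤ a → a ≤ b → b ≤ T →
      ‖caputoInt α x b - caputoInt α x a‖ ≤ c * (1 + B) * (b - a) := by
    intro a b ha hab hb
    have ha' := p.1.t.2.1.trans ha
    refine (hx.2 a b ha hab hb).trans ?_
    have h1 : ∫ τ in a..b, c * (1 + ‖ext x τ‖) ≤ ∫ τ in a..b, c * (1 + B) := by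
      refine intervalIntegral.integral_mono_on hab
        (intervalIntegrable_growth c x ⟨ha', hab.trans hb⟩
          ⟨ha'.trans hab, hb⟩) intervalIntegrable_const fun τ hτ => ?_
      have := hxB τ ⟨ha'.trans hτ.1, hτ.2.trans hb⟩
      gcongr
    rw [intervalIntegral.integral_const, smul_eq_mul, mul_comm] at h1
    exact h1
  have h3 : ∀ a b, 0 ≤ a → a ≤ b → b ≤ T →
      ‖caputoInt α x b - caputoInt α x a‖ ≤ (K + c * (1 + B)) * (b - a) := by
    intro a b ha hab hb
    have hK0 := K.2
    have hs := sub_nonneg.2 hab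
    rcases le_total b (p.1.t : ℝ) with h | h
    · refine (h1 a b ha hab h).trans (mul_le_mul_of_nonneg_right ?_ hs)
      linarith
    rcases le_total (p.1.t : ℝ) a with h' | h'
    · refine (h2 a b h' hab hb).trans (mul_le_mul_of_nonneg_right ?_ hs)
      linarith
    · have e1 := h1 a _ ha h' le_rfl
      have e2 := h2 _ b le_rfl h hb
      have e3 : K * ((p.1.t : ℝ) - a) ≤ K * (b - a) := mul_le_mul_of_nonneg_left (by linarith) hK0
      have e4 : c * (1 + B) * (b - (p.1.t : ℝ)) ≤ c * (1 + B) * (b - a) :=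
        mul_le_mul_of_nonneg_left (by linarith) hL
      have e5 := norm_sub_le_norm_sub_add_norm_sub (caputoInt α x b)
        (caputoInt α x (p.1.t : ℝ)) (caputoInt α x a)
      rw [add_mul]
      linarith
  refine LipschitzOnWith.of_dist_le_mul fun a ha b hb => ?_
  rw [dist_eq_norm, Real.dist_eq]
  rcases le_total a b with h | h
  · rw [norm_sub_rev, abs_sub_comm, abs_of_nonneg (sub_nonneg.2 h)]
    exact h3 a b ha.1 h hb.2
  · rw [abs_of_nonneg (sub_nonneg.2 h)]
    exact h3 b a hb.1 h ha.2

theorem exists_lipschitzOn_of_mem {T : ℝ} {n : ℕ} {α c : ℝ} (hα : α ∈ Ioo (0 : ℝ) 1) (hc : 0 ≤ c)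
    {p : ACHist T n α} {x : C(Icc (0 : ℝ) T, Vec n)} (hx : x ∈ admissible c p) :
    ∃ K, LipschitzOnWith K (caputoInt α x) (Icc 0 T) := by
  obtain ⟨K, hK⟩ := p.2.exists_lipschitzOn hα
  obtain ⟨B, hB⟩ := isCompact_Icc.exists_bound_of_continuousOn (continuousOn_ext x)
  exact ⟨_, lipschitzOn_of_mem hc hK hx (le_max_right B 0)
    fun τ hτ => (hB τ hτ).trans (le_max_left _ _)⟩

/-- Gronwall for `1 + ‖x‖`. The Caputo derivative is bounded by `K` before `t₀` and by `c (1 + ‖x‖)`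
after it; since `1 ≤ 1 + ‖x‖`, the coefficient `K + c` serves on both sides. -/
theorem exists_bound_of_mem {T : ℝ} {n : ℕ} {α c : ℝ} (hT : 0 < T) (hα : α ∈ Ioo (0 : ℝ) 1)
    (hc : 0 ≤ c) (p : ACHist T n α) : ∃ B, 0 ≤ B ∧ ∀ x ∈ admissible c p,
      ∀ τ ∈ Icc 0 T, ‖ext x τ‖ ≤ B := by
  obtain ⟨K, hK⟩ := p.2.exists_lipschitzOn hα
  have hK0 := K.2
  obtain ⟨B, hB⟩ := exists_bound_of_le_fracInt (c := K + c) hα.1 (by positivity) T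
    (1 + ‖ext p.1.w 0‖) (by positivity)
  refine ⟨max B 0, le_max_right _ _, fun x hx τ hτ => le_trans ?_ (le_max_left _ _)⟩
  have hcont : ContinuousOn (fun τ => 1 + ‖ext x τ‖) (Icc 0 T) :=
    continuousOn_const.add (continuousOn_ext x).norm
  have hle : ∀ᵐ ξ, ξ ∈ Ioo 0 T → ‖caputo α x ξ‖ ≤ (K + c) * (1 + ‖ext x ξ‖) := by
    have hne : ∀ᵐ ξ : ℝ, ξ ≠ p.1.t := by simp [ae_iff, measure_singleton]
    filter_upwards [hne] with ξ hne hξ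
    have h1 : 0 ≤ ‖ext x ξ‖ := norm_nonneg _
    rcases lt_or_gt_of_ne hne with h | h
    · have hL : LipschitzOnWith K (caputoInt α x) (Icc 0 (p.1.t : ℝ)) := by
        intro a ha b hb
        rw [caputoInt_congr ha.1 fun ξ hξ => hx.1 ξ ⟨hξ.1, hξ.2.trans ha.2⟩,
          caputoInt_congr hb.1 fun ξ hξ => hx.1 ξ ⟨hξ.1, hξ.2.trans hb.2⟩]
        exact hK ha hb
      have h2 : ‖caputo α x ξ‖ ≤ K := by
        rw [caputo_eq_deriv]
        exact norm_deriv_le_of_lipschitzOn (Icc_mem_nhds hξ.1 h) hL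
      nlinarith [mul_nonneg hK0 h1, mul_nonneg hc h1]
    · have := caputo_norm_le_of_mem hc hx ⟨h, hξ.2⟩
      nlinarith [mul_nonneg hK0 h1]
  have h := hB (fun τ => 1 + ‖ext x τ‖) hcont (fun t _ => by positivity) (fun t ht => ?_) τ hτ
  · linarith
  obtain ⟨L, hL⟩ := exists_lipschitzOn_of_mem hα hc hx
  have h0 : ext x 0 = ext p.1.w 0 := hx.1 0 ⟨le_rfl, p.1.t.2.1⟩
  rw [ext_eq_of_lipschitzOn hT hα hL ht, h0, add_assoc]
  refine add_le_add_right ((norm_add_le _ _).trans (add_le_add_right ?_ _)) _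
  have hne : ∀ᵐ ξ : ℝ, ξ ≠ T := by simp [ae_iff, measure_singleton]
  refine norm_fracInt_le_of_norm_le hα.1 ht.1 ?_ ?_
  · refine (intervalIntegrable_kernel hα.1 ht.1 le_rfl).mul_continuousOn
      (continuousOn_const.mul (hcont.mono ?_))
    rw [uIcc_of_le ht.1]
    exact Icc_subset_Icc_right ht.2
  · filter_upwards [hle, hne] with ξ hξ hne hm
    exact hξ ⟨hm.1, lt_of_le_of_ne (hm.2.trans ht.2) hne⟩

theorem continuous_integral_ext {T : ℝ} {n : ℕ} {a b : ℝ} (ha : a ∈ Icc 0 T)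
    (hb : b ∈ Icc 0 T) {g : ℝ → Vec n → ℝ}
    (hg : ContinuousOn (fun y : ℝ × Vec n => g y.1 y.2) (Icc 0 T ×ˢ univ)) :
    Continuous fun x : C(Icc (0 : ℝ) T, Vec n) => ∫ τ in a..b, g τ (ext x τ) := by
  have hT : (0 : ℝ) ≤ T := ha.1.trans ha.2
  -- `ext x` may jump at the ends of `[0, T]`; composing with `projIcc` gives an integrand that is
  -- jointly continuous on the whole line.
  have hc : Continuous (Function.uncurry fun (x : C(Icc (0 : ℝ) T, Vec n)) (τ : ℝ) =>
      g (projIcc 0 T hT τ) (x (projIcc 0 T hT τ))) := by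
    refine hg.comp_continuous (f := fun q : C(Icc (0 : ℝ) T, Vec n) × ℝ =>
      (((projIcc 0 T hT q.2 : Icc (0 : ℝ) T) : ℝ), q.1 (projIcc 0 T hT q.2))) ?_ fun q =>
        ⟨(projIcc 0 T hT q.2).2, mem_univ _⟩
    have h1 : Continuous fun q : C(Icc (0 : ℝ) T, Vec n) × ℝ => projIcc 0 T hT q.2 :=
      continuous_projIcc.comp continuous_snd
    exact (continuous_subtype_val.comp h1).prodMk (continuous_fst.eval h1)
  refine (intervalIntegral.continuous_parametric_intervalIntegral_of_continuous
    (a₀ := a) (μ := volume) hc (continuous_const (y := b))).congr fun x => ?_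
  refine intervalIntegral.integral_congr fun τ hτ => ?_
  have hτ' := uIcc_subset_Icc ha hb hτ
  simp only [projIcc_of_mem hT hτ', ext_of_mem x hτ']

theorem continuous_ext_apply {T : ℝ} {n : ℕ} {τ : ℝ} (hτ : τ ∈ Icc 0 T) :
    Continuous fun x : C(Icc (0 : ℝ) T, Vec n) => ext x τ := by
  simp only [ext_of_mem _ hτ]
  exact continuous_eval_const _

theorem isClosed_admissible {T : ℝ} {n : ℕ} {α : ℝ} (hα : α ∈ Ioo (0 : ℝ) 1) (c : ℝ)
    (p : ACHist T n α) : IsClosed (admissible c p) := by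
  have he : admissible c p =
      (⋂ τ ∈ Icc 0 (p.1.t : ℝ), {x : C(Icc (0 : ℝ) T, Vec n) | ext x τ = ext p.1.w τ}) ∩
        ⋂ (a : ℝ) (b : ℝ) (_ : (p.1.t : ℝ) ≤ a) (_ : a ≤ b) (_ : b ≤ T),
          {x : C(Icc (0 : ℝ) T, Vec n) |
            ‖caputoInt α x b - caputoInt α x a‖ ≤ ∫ τ in a..b, c * (1 + ‖ext x τ‖)} := by
    ext x
    simp [admissible]
  rw [he]
  refine IsClosed.inter ?_ ?_
  · refine isClosed_biInter fun τ hτ => isClosed_eq ?_ continuous_const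
    exact continuous_ext_apply ⟨hτ.1, hτ.2.trans p.1.t.2.2⟩
  · refine isClosed_iInter fun a => isClosed_iInter fun b => isClosed_iInter fun ha =>
      isClosed_iInter fun hab => isClosed_iInter fun hb => ?_
    have ha' : a ∈ Icc 0 T := ⟨p.1.t.2.1.trans ha, hab.trans hb⟩
    have hb' : b ∈ Icc 0 T := ⟨ha'.1.trans hab, hb⟩
    refine isClosed_le ((continuous_caputoInt hα hb').sub (continuous_caputoInt hα ha')).norm
      (continuous_integral_ext ha' hb' (g := fun _ v => c * (1 + ‖v‖)) ?_)
    fun_prop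

theorem isCompact_of_isClosed_of_equicontinuous {X E : Type*} [TopologicalSpace X] [CompactSpace X]
    [MetricSpace E] [ProperSpace E] {S : Set C(X, E)} (hS : IsClosed S) {K : Set E}
    (hK : IsCompact K) (hSK : ∀ f ∈ S, ∀ x, f x ∈ K)
    (heq : Equicontinuous fun f : S => (f.1 : X → E)) : IsCompact S := by
  let e := ContinuousMap.isometryEquivBoundedOfCompact X E
  have h := BoundedContinuousFunction.arzela_ascoli₂ K hK (e.symm ⁻¹' S)
    (hS.preimage e.symm.continuous) (fun f x hf => hSK _ hf x)
    (heq.comp fun f : e.symm ⁻¹' S => (⟨e.symm f.1, f.2⟩ : S))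
  have := h.image e.symm.continuous
  rwa [image_preimage_eq _ e.symm.surjective] at this

/-- Arzelà-Ascoli: the Gronwall bound keeps the values in a ball, and the common bound on the Caputo
derivatives gives a common Hölder modulus of exponent `α`. -/
theorem isCompact_admissible {T : ℝ} {n : ℕ} {α c : ℝ} (hT : 0 < T) (hα : α ∈ Ioo (0 : ℝ) 1)
    (hc : 0 ≤ c) (p : ACHist T n α) : IsCompact (admissible c p) := by
  obtain ⟨K, hK⟩ := p.2.exists_lipschitzOn hα
  obtain ⟨B, hB0, hB⟩ := exists_bound_of_mem hT hα hc p
  refine isCompact_of_isClosed_of_equicontinuous (isClosed_admissible hα c p)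
    (isCompact_closedBall (0 : Vec n) B) (fun x hx τ => ?_) ?_
  · rw [mem_closedBall_zero_iff]
    have := hB x hx τ τ.2
    rwa [ext_of_mem x τ.2] at this
  set M : NNReal := K + ⟨c * (1 + B), by positivity⟩ with hM
  set D : ℝ := 1 / Real.Gamma α * (2 * M / α) with hD
  have hlim : Filter.Tendsto (fun r : ℝ => D * r ^ α) (nhds 0) (nhds 0) := by
    have : Continuous fun r : ℝ => D * r ^ α :=
      continuous_const.mul (continuous_id.rpow_const fun _ => Or.inr hα.1.le)
    simpa [Real.zero_rpow hα.1.ne'] using this.tendsto 0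
  refine Metric.equicontinuous_of_continuity_modulus (fun r => D * r ^ α) hlim _
    fun a b x => ?_
  have hL := lipschitzOn_of_mem hc hK x.2 hB0 (hB x.1 x.2)
  have hb := bddOn_deriv_of_lipschitzOn hL
  have key : ∀ a b : Icc (0 : ℝ) T, a ≤ b → ‖x.1 b - x.1 a‖ ≤ D * dist a b ^ α := by
    intro a b hab
    have hab' : (a : ℝ) ≤ b := hab
    rw [← ext_of_mem x.1 a.2, ← ext_of_mem x.1 b.2, ext_eq_of_lipschitzOn hT hα hL a.2,
      ext_eq_of_lipschitzOn hT hα hL b.2, add_sub_add_left_eq_sub, Subtype.dist_eq, Real.dist_eq,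
      abs_sub_comm, abs_of_nonneg (sub_nonneg.2 hab')]
    exact hb.norm_fracInt_sub_le M.2 hα.1 hα.2.le a.2.1 hab' b.2.2
  rcases le_total a b with h | h
  · rw [dist_eq_norm, norm_sub_rev]
    exact key a b h
  · rw [dist_eq_norm, dist_comm]
    exact key b a h

/-! ### Building admissible paths from piecewise densities -/

theorem mem_admissible_of_density {T : ℝ} {n : ℕ} {α c M : ℝ} (hα : α ∈ Ioo (0 : ℝ) 1)
    {p : ACHist T n α} {x : C(Icc (0 : ℝ) T, Vec n)} {x₀ : Vec n} {ψ : ℝ → Vec n}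
    (hψ : BddOn T M ψ) (hx : ∀ ξ ∈ Icc 0 T, ext x ξ = x₀ + fracInt α ψ ξ)
    (hp : ∀ τ ∈ Icc 0 (p.1.t : ℝ), ext x τ = ext p.1.w τ)
    (hle : ∀ᵐ τ, τ ∈ Ioc (p.1.t : ℝ) T → ‖ψ τ‖ ≤ c * (1 + ‖ext x τ‖)) : x ∈ admissible c p := by
  refine ⟨hp, fun a b ha hab hb => ?_⟩
  have ha' : a ∈ Icc 0 T := ⟨p.1.t.2.1.trans ha, hab.trans hb⟩
  have hb' : b ∈ Icc 0 T := ⟨ha'.1.trans hab, hb⟩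
  have h0 : (0 : ℝ) ∈ Icc 0 T := ⟨le_rfl, ha'.1.trans ha'.2⟩
  rw [hψ.caputoInt_eq hα hx ha', hψ.caputoInt_eq hα hx hb',
    intervalIntegral.integral_interval_sub_left
    (hψ.intervalIntegrable h0 hb') (hψ.intervalIntegrable h0 ha')]
  refine intervalIntegral.norm_integral_le_of_norm_le hab ?_
    (intervalIntegrable_growth c x ha' hb')
  filter_upwards [hle] with τ hτ hm
  exact hτ ⟨ha.trans_lt hm.1, hm.2.trans hb⟩

/-- `ψ` is controlled only where it is used: the density of `w₀` is known to be bounded only on `[0,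
t₀]`. -/
theorem BddOn.piecewise {n : ℕ} {T M M' : ℝ} {ψ χ : ℝ → Vec n} (t₁ : ℝ)
    (h : BddOn (min t₁ T) M ψ) (h' : BddOn T M' χ) :
    BddOn T (max M M') (fun τ => if τ ≤ t₁ then ψ τ else χ τ) := by
  have e1 : (volume.restrict (Icc 0 T)).restrict (Iic t₁) = volume.restrict (Icc 0 (min t₁ T)) := by
    rw [Measure.restrict_restrict measurableSet_Iic]
    congr 1
    ext τ
    simp only [mem_inter_iff, mem_Iic, mem_Icc, le_min_iff]
    tauto
  constructor
  · refine AEStronglyMeasurable.piecewise (s := Iic t₁) measurableSet_Iic (f := ψ) (g := χ) ?_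
      h'.meas.restrict
    rw [e1]
    exact h.meas
  · have h1 := (ae_restrict_iff' measurableSet_Icc).1 h.bound
    have h2 := (ae_restrict_iff' measurableSet_Icc).1 h'.bound
    refine (ae_restrict_iff' measurableSet_Icc).2 ?_
    filter_upwards [h1, h2] with τ h1 h2 hm
    split_ifs with hle
    · exact (h1 ⟨hm.1, le_min hle hm.2⟩).trans (le_max_left _ _)
    · exact (h2 hm).trans (le_max_right _ _)

theorem bddOn_const {n : ℕ} (T : ℝ) (e : Vec n) : BddOn T ‖e‖ fun _ => e :=
  ⟨aestronglyMeasurable_const, .of_forall fun _ => le_rfl⟩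

/-- The density of `w₀` is continued by zero. The path itself need not be constant after `t₀`,
because `I^α` keeps the memory of the past. -/
theorem admissible_nonempty {T : ℝ} {n : ℕ} {α c : ℝ} (hα : α ∈ Ioo (0 : ℝ) 1) (hc : 0 ≤ c)
    (p : ACHist T n α) : (admissible c p).Nonempty := by
  obtain ⟨ψ, hψ, h⟩ := p.2
  obtain ⟨M, hM, hb⟩ := exists_bddOn_of_memLp hψ
  have hb' : BddOn (min (p.1.t : ℝ) T) M ψ := by rwa [min_eq_left p.1.t.2.2]
  have hχ := hb'.piecewise (p.1.t : ℝ) (bddOn_const T (0 : Vec n))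
  obtain ⟨x, hx⟩ := hχ.exists_path (le_max_of_le_left hM) hα (ext p.1.w 0)
  refine ⟨x, mem_admissible_of_density hα hχ hx (fun τ hτ => ?_) (.of_forall fun τ hτ => ?_)⟩
  · rw [hx τ ⟨hτ.1, hτ.2.trans p.1.t.2.2⟩, ext_of_mem p.1.w hτ, h ⟨τ, hτ⟩,
      ext_of_mem p.1.w ⟨le_rfl, p.1.t.2.1⟩,
      fracInt_congr (g := ψ) hτ.1 fun ξ hξ => if_pos (hξ.2.trans hτ.2)]
  · rw [if_neg (not_le.2 hτ.1), norm_zero]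
    positivity

/-- An admissible path can be continued after `t₁` so that its Caputo derivative is a prescribed
constant on a small interval. -/
theorem exists_extension {T : ℝ} {n : ℕ} {α c : ℝ} (hT : 0 < T) (hα : α ∈ Ioo (0 : ℝ) 1)
    (hc : 0 ≤ c) {p : ACHist T n α} {x : C(Icc (0 : ℝ) T, Vec n)} (hx : x ∈ admissible c p)
    {t₁ : ℝ} (ht₁ : t₁ ∈ Ico (p.1.t : ℝ) T) {e : Vec n} (he : ‖e‖ < c * (1 + ‖ext x t₁‖)) :
    ∃ x' ∈ admissible c p, ∃ δ > 0, t₁ + δ ≤ T ∧ (∀ τ ∈ Icc 0 t₁, ext x' τ = ext x τ) ∧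
      ∀ t ∈ Icc t₁ (t₁ + δ), caputoInt α x' t = caputoInt α x t₁ + (t - t₁) • e := by
  obtain ⟨K, hK⟩ := exists_lipschitzOn_of_mem hα hc hx
  have ht₁0 : 0 ≤ t₁ := p.1.t.2.1.trans ht₁.1
  have ht₁' : t₁ ∈ Icc 0 T := ⟨ht₁0, ht₁.2.le⟩
  have hb := bddOn_deriv_of_lipschitzOn hK
  have h1 := (hb.mono (min_le_right t₁ T)).piecewise t₁ (bddOn_const T e)
  obtain ⟨y, hy⟩ := h1.exists_path (le_max_of_le_left K.2) hα (ext x 0)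
  have hyx : ∀ τ ∈ Icc 0 t₁, ext y τ = ext x τ := fun τ hτ => by
    have hτ' : τ ∈ Icc 0 T := ⟨hτ.1, hτ.2.trans ht₁.2.le⟩
    rw [hy τ hτ', ext_eq_of_lipschitzOn hT hα hK hτ',
      caputo_eq_deriv,
      fracInt_congr (g := deriv (caputoInt α x)) hτ.1 fun ξ hξ => if_pos (hξ.2.trans hτ.2)]
  -- The strict bound on `e` at `t₁` persists for a short time by continuity of `y`.
  obtain ⟨δ, hδ, hδT, hδle⟩ : ∃ δ > 0, t₁ + δ ≤ T ∧
      ∀ τ ∈ Icc t₁ (t₁ + δ), ‖e‖ ≤ c * (1 + ‖ext y τ‖) := by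
    have hcw := (continuousOn_growth c y) t₁ ht₁'
    rw [← hyx t₁ ⟨ht₁0, le_rfl⟩] at he
    have hev := hcw.eventually (lt_mem_nhds he)
    obtain ⟨r, hr, hball⟩ := Metric.mem_nhdsWithin_iff.1 hev
    refine ⟨min (r / 2) (T - t₁), lt_min (by linarith) (sub_pos.2 ht₁.2),
      by linarith [min_le_right (r / 2) (T - t₁)], fun τ hτ => ?_⟩
    have hm1 := min_le_left (r / 2) (T - t₁)
    have hm2 := min_le_right (r / 2) (T - t₁)
    refine le_of_lt (hball ⟨?_, ht₁0.trans hτ.1, by linarith [hτ.2]⟩)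
    rw [Metric.mem_ball, Real.dist_eq, abs_of_nonneg (sub_nonneg.2 hτ.1)]
    linarith [hτ.2]
  -- Beyond `t₁ + δ` the constant `e` could violate the growth condition, so the density is switched
  -- to zero; earlier values are unaffected, as fractional integrals see only the past.
  have h2 := (h1.mono (min_le_right (t₁ + δ) T)).piecewise (t₁ + δ) (bddOn_const T (0 : Vec n))
  obtain ⟨x', hx'⟩ := h2.exists_path (le_max_of_le_left (le_max_of_le_left K.2)) hα (ext x 0)
  have hxy : ∀ τ ∈ Icc 0 (t₁ + δ), ext x' τ = ext y τ := fun τ hτ => by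
    have hτ' : τ ∈ Icc 0 T := ⟨hτ.1, hτ.2.trans hδT⟩
    rw [hx' τ hτ', hy τ hτ']
    congr 1
    exact fracInt_congr hτ.1 fun ξ hξ => if_pos (hξ.2.trans hτ.2)
  have hxx : ∀ τ ∈ Icc 0 t₁, ext x' τ = ext x τ := fun τ hτ => by
    rw [hxy τ ⟨hτ.1, by linarith [hτ.2]⟩, hyx τ hτ]
  refine ⟨x', mem_admissible_of_density hα h2 hx' (fun τ hτ => ?_) ?_, δ, hδ, hδT, hxx,
    fun t ht => ?_⟩
  · rw [hxx τ ⟨hτ.1, hτ.2.trans ht₁.1⟩, hx.1 τ hτ]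
  · have hne : ∀ᵐ ξ : ℝ, ξ ≠ T := by simp [ae_iff, measure_singleton]
    filter_upwards [hne] with τ hne hτ
    have hτ0 : 0 ≤ τ := p.1.t.2.1.trans hτ.1.le
    split_ifs with hl hl'
    · rw [hxx τ ⟨hτ0, hl'⟩]
      exact caputo_norm_le_of_mem hc hx ⟨hτ.1, lt_of_le_of_ne hτ.2 hne⟩
    · rw [hxy τ ⟨hτ0, hl⟩]
      exact hδle τ ⟨(not_le.1 hl').le, hl⟩
    · rw [norm_zero]
      positivity
  · have ht' : t ∈ Icc 0 T := ⟨ht₁0.trans ht.1, ht.2.trans hδT⟩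
    have h0 : (0 : ℝ) ∈ Icc 0 T := ⟨le_rfl, hT.le⟩
    rw [← caputoInt_congr (x := x') ht₁0 hxx, ← sub_eq_iff_eq_add', h2.caputoInt_eq hα hx' ht',
      h2.caputoInt_eq hα hx' ht₁', intervalIntegral.integral_interval_sub_left
      (h2.intervalIntegrable h0 ht') (h2.intervalIntegrable h0 ht₁'),
      ← intervalIntegral.integral_const]
    refine intervalIntegral.integral_congr_ae (.of_forall fun τ hτ => ?_)
    rw [uIoc_of_le ht.1] at hτ
    rw [if_pos (hτ.2.trans ht.2), if_neg (not_le.2 hτ.1)]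

/-! ### Continuity of the restriction `x_t` in the metric of histories -/

theorem histDist_le {T : ℝ} {n : ℕ} {p q : Hist T n} {r : ℝ}
    (h : ∀ τ, ∃ τ', graphDist p q τ τ' ≤ r) (h' : ∀ τ, ∃ τ', graphDist q p τ τ' ≤ r) :
    dist p q ≤ r := by
  refine max_le (ciSup_le fun τ => ?_) (ciSup_le fun τ => ?_)
  · obtain ⟨τ', hτ'⟩ := h τ
    exact (ciInf_le (bddBelow_graphDist p q τ) τ').trans hτ'
  · obtain ⟨τ', hτ'⟩ := h' τ
    exact (ciInf_le (bddBelow_graphDist q p τ) τ').trans hτ'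

theorem graphDist_upTo_le {T : ℝ} {n : ℕ} {α : ℝ} (x x' : ACPath T n α) {t t' : Icc (0 : ℝ) T}
    (τ : Icc (0 : ℝ) t) (τ' : Icc (0 : ℝ) t') :
    graphDist (x.upTo t).1 (x'.upTo t').1 τ τ' ≤ |(τ : ℝ) - τ'| +
      dist (x.1 ⟨τ, τ.2.1, τ.2.2.trans t.2.2⟩) (x'.1 ⟨τ', τ'.2.1, τ'.2.2.trans t'.2.2⟩) := by
  change Real.sqrt (|(τ : ℝ) - τ'| ^ 2 + ‖x.1 ⟨τ, τ.2.1, τ.2.2.trans t.2.2⟩ -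
    x'.1 ⟨τ', τ'.2.1, τ'.2.2.trans t'.2.2⟩‖ ^ 2) ≤ _
  rw [← dist_eq_norm]
  refine Real.sqrt_le_iff.2 ⟨by positivity, ?_⟩
  nlinarith [abs_nonneg ((τ : ℝ) - τ'), dist_nonneg (x := x.1 ⟨τ, τ.2.1, τ.2.2.trans t.2.2⟩)
    (y := x'.1 ⟨τ', τ'.2.1, τ'.2.2.trans t'.2.2⟩)]

theorem continuous_upTo_left {T : ℝ} {n : ℕ} {α : ℝ} (t : Icc (0 : ℝ) T) :
    Continuous fun x : ACPath T n α => x.upTo t := by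
  have key : ∀ (x x' : ACPath T n α) (τ : Icc (0 : ℝ) t),
      graphDist (x.upTo t).1 (x'.upTo t).1 τ τ ≤ dist x x' := by
    intro x x' τ
    refine (graphDist_upTo_le x x' τ τ).trans ?_
    rw [sub_self, abs_zero, zero_add]
    exact ContinuousMap.dist_apply_le_dist _
  refine (LipschitzWith.of_dist_le_mul (K := 1) fun x x' => ?_).continuous
  rw [NNReal.coe_one, one_mul]
  refine histDist_le (fun τ => ⟨τ, key x x' τ⟩) (fun τ => ⟨τ, ?_⟩)
  rw [dist_comm]
  exact key x' x τ

theorem continuous_upTo_right {T : ℝ} {n : ℕ} {α : ℝ} (x : ACPath T n α) :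
    Continuous fun t : Icc (0 : ℝ) T => x.upTo t := by
  refine Metric.continuous_iff.2 fun t ε hε => ?_
  obtain ⟨δ, hδ, hx⟩ := Metric.uniformContinuous_iff.1
    (CompactSpace.uniformContinuous_of_continuous x.1.continuous) (ε / 4) (by linarith)
  have key : ∀ t t' : Icc (0 : ℝ) T, |(t : ℝ) - t'| < min δ (ε / 4) → ∀ τ : Icc (0 : ℝ) t,
      ∃ τ' : Icc (0 : ℝ) t', graphDist (x.upTo t).1 (x.upTo t').1 τ τ' ≤ ε / 2 := by
    intro t t' ht τ
    -- The graph point at `τ` is matched with the one at the truncated time `min τ t'`; uniform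
    -- continuity of `x` controls the values.
    refine ⟨⟨min τ t', le_min τ.2.1 t'.2.1, min_le_right _ _⟩, ?_⟩
    have hτ : |(τ : ℝ) - min (τ : ℝ) t'| < min δ (ε / 4) := by
      refine lt_of_le_of_lt ?_ ht
      rcases le_total (τ : ℝ) t' with h | h
      · rw [min_eq_left h, sub_self, abs_zero]
        exact abs_nonneg _
      · rw [min_eq_right h, abs_of_nonneg (sub_nonneg.2 h)]
        exact (sub_le_sub_right τ.2.2 _).trans (le_abs_self _)
    have hd := hx (a := ⟨τ, τ.2.1, τ.2.2.trans t.2.2⟩)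
      (b := ⟨min τ t', le_min τ.2.1 t'.2.1, (min_le_right _ _).trans t'.2.2⟩)
      (hτ.trans_le (min_le_left _ _))
    have hle := graphDist_upTo_le x x (t := t) (t' := t') τ
      ⟨min τ t', le_min τ.2.1 t'.2.1, min_le_right _ _⟩
    have h4 := hτ.trans_le (min_le_right _ _)
    refine hle.trans ?_
    simp only
    linarith
  refine ⟨min δ (ε / 4), lt_min hδ (by linarith), fun t' ht' => ?_⟩
  have h1 : |(t' : ℝ) - t| < min δ (ε / 4) := ht'
  refine lt_of_le_of_lt (histDist_le (key t' t h1) (key t t' ?_)) (half_lt_self hε)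
  rwa [abs_sub_comm]

theorem upTo_congr {T : ℝ} {n : ℕ} {α : ℝ} {x x' : ACPath T n α} {t : Icc (0 : ℝ) T}
    (h : ∀ τ ∈ Icc 0 (t : ℝ), ext x.1 τ = ext x'.1 τ) : x.upTo t = x'.upTo t := by
  have : x.1.comp (ContinuousMap.inclusion (Icc_subset_Icc_right t.2.2)) =
      x'.1.comp (ContinuousMap.inclusion (Icc_subset_Icc_right t.2.2)) := by
    ext1 τ
    have := h τ τ.2
    rwa [ext_of_mem _ ⟨τ.2.1, τ.2.2.trans t.2.2⟩, ext_of_mem _ ⟨τ.2.1, τ.2.2.trans t.2.2⟩] at this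
  refine Subtype.ext ?_
  simp only [ACPath.upTo, this]

theorem extends_of_ext {T : ℝ} {n : ℕ} {α : ℝ} {x : ACPath T n α} {p : ACHist T n α}
    (h : ∀ τ ∈ Icc 0 (p.1.t : ℝ), ext x.1 τ = ext p.1.w τ) : Extends x p := fun τ => by
  have := h τ τ.2
  rwa [ext_of_mem _ ⟨τ.2.1, τ.2.2.trans p.1.t.2.2⟩, ext_of_mem _ τ.2] at this

theorem Extends.upTo_eq {T : ℝ} {n : ℕ} {α : ℝ} {x : ACPath T n α} {p : ACHist T n α}
    (h : Extends x p) : x.upTo p.1.t = p := by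
  obtain ⟨⟨t, w⟩, hw⟩ := p
  have : x.1.comp (ContinuousMap.inclusion (Icc_subset_Icc_right t.2.2)) = w := by
    ext1 τ
    exact h τ
  refine Subtype.ext ?_
  simp only [ACPath.upTo, this]

/-! ### The continuation principle -/

/-- A continuation principle: a continuous family of functions on `[t₀, T]`, indexed by a compact
space, whose members can be continued from every instant with an arbitrarily small slope, has a
member that vanishes. -/
theorem exists_eq_zero_of_continuation {X : Type*} [TopologicalSpace X] [CompactSpace X]
    [Nonempty X] {D : X → ℝ → ℝ} {t₀ T : ℝ} (hT : t₀ ≤ T)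
    (hx : ∀ t ∈ Icc t₀ T, Continuous fun x => D x t)
    (ht : ∀ x, ContinuousOn (D x) (Icc t₀ T)) (h0 : ∀ x, D x t₀ = 0)
    (hext : ∀ ε > 0, ∀ x, ∀ t₁ ∈ Ico t₀ T, ∃ x', ∃ δ > 0, t₁ + δ ≤ T ∧
      (∀ t ∈ Icc t₀ t₁, D x' t = D x t) ∧
      ∀ t ∈ Icc t₁ (t₁ + δ), |D x' t - D x t₁| ≤ ε * (t - t₁)) :
    ∃ x, ∀ t ∈ Icc t₀ T, D x t = 0 := by
  have hclosed : ∀ ε : ℝ, ∀ s ≤ T, IsClosed {x | ∀ t ∈ Icc t₀ s, |D x t| ≤ ε * (t - t₀)} := by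
    intro ε s hs
    have : {x | ∀ t ∈ Icc t₀ s, |D x t| ≤ ε * (t - t₀)} =
        ⋂ t ∈ Icc t₀ s, {x | |D x t| ≤ ε * (t - t₀)} := by
      ext x
      simp
    rw [this]
    exact isClosed_biInter fun t htm =>
      isClosed_le (hx t ⟨htm.1, htm.2.trans hs⟩).abs continuous_const
  have happrox : ∀ ε > 0, ∃ x, ∀ t ∈ Icc t₀ T, |D x t| ≤ ε * (t - t₀) := by
    intro ε hε
    set S : Set ℝ := {s | ∃ x, ∀ t ∈ Icc t₀ s, |D x t| ≤ ε * (t - t₀)} with hS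
    have h0S : t₀ ∈ S := by
      obtain ⟨x⟩ := ‹Nonempty X›
      refine ⟨x, fun t htm => ?_⟩
      rw [le_antisymm htm.2 htm.1, h0]
      simp
    have hmono : ∀ s ∈ S, ∀ s' ≤ s, s' ∈ S := fun s ⟨x, h⟩ s' hs' =>
      ⟨x, fun t htm => h t ⟨htm.1, htm.2.trans hs'⟩⟩
    suffices h : Icc t₀ T ⊆ S from h ⟨hT, le_rfl⟩
    -- Induction along the real interval: `S` is closed in `[t₀, T]` and can be enlarged to the
    -- right of each of its points below `T`.
    refine IsClosed.Icc_subset_of_forall_exists_gt ?_ h0S ?_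
    · refine isClosed_of_closure_subset fun t₁ ht₁ => ?_
      have ht₁' : t₁ ∈ Icc t₀ T :=
        isClosed_Icc.closure_subset (closure_mono inter_subset_right ht₁)
      refine ⟨?_, ht₁'⟩
      rcases ht₁'.1.eq_or_lt with rfl | hlt
      · exact h0S
      have hlow : ∀ s ∈ Ico t₀ t₁, s ∈ S := by
        intro s hs
        obtain ⟨u, hu, hd⟩ := Metric.mem_closure_iff.1 ht₁ (t₁ - s) (sub_pos.2 hs.2)
        refine hmono u hu.1 s ?_
        rw [Real.dist_eq] at hd
        linarith [le_abs_self (t₁ - u)]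
      have : Nonempty (Ico t₀ t₁) := ⟨⟨t₀, le_rfl, hlt⟩⟩
      -- The members that work up to different `s < t₁` may be unrelated; nested nonempty compact
      -- sets supply one that works for all of them.
      obtain ⟨x, hxm⟩ := IsCompact.nonempty_iInter_of_directed_nonempty_isCompact_isClosed
        (fun s : Ico t₀ t₁ => {x | ∀ t ∈ Icc t₀ (s : ℝ), |D x t| ≤ ε * (t - t₀)})
        (fun s s' => ⟨max s s', fun x h t htm => h t ⟨htm.1, htm.2.trans
            (show (s : ℝ) ≤ ((max s s' : Ico t₀ t₁) : ℝ) from le_max_left s s')⟩,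
          fun x h t htm => h t ⟨htm.1, htm.2.trans
            (show (s' : ℝ) ≤ ((max s s' : Ico t₀ t₁) : ℝ) from le_max_right s s')⟩⟩)
        (fun s => hlow s s.2)
        (fun s => (hclosed ε s (s.2.2.le.trans ht₁'.2)).isCompact)
        (fun s => hclosed ε s (s.2.2.le.trans ht₁'.2))
      rw [mem_iInter] at hxm
      have hcl : closure (Ico t₀ t₁) = Icc t₀ t₁ := closure_Ico hlt.ne
      refine ⟨x, fun t htm => ?_⟩
      refine le_on_closure (s := Ico t₀ t₁) (f := fun t => |D x t|) (g := fun t => ε * (t - t₀))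
        (fun t h => hxm ⟨t, h⟩ t ⟨h.1, le_rfl⟩) ?_ (by fun_prop) (by rwa [hcl])
      rw [hcl]
      exact ((ht x).mono (Icc_subset_Icc_right ht₁'.2)).abs
    · rintro t₁ ⟨⟨x, h⟩, ht₁⟩ y hy
      obtain ⟨x', δ, hδ, hδT, hold, hnew⟩ := hext ε hε x t₁ ht₁
      refine ⟨min (t₁ + δ) y, hmono (t₁ + δ) ⟨x', fun t htm => ?_⟩ _ (min_le_left _ _),
        lt_min (by linarith) hy, min_le_right _ _⟩
      rcases le_total t t₁ with hle | hle
      · rw [hold t ⟨htm.1, hle⟩]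
        exact h t ⟨htm.1, hle⟩
      -- The errors add up exactly: `ε (t₁ - t₀) + ε (t - t₁) = ε (t - t₀)`.
      · have e1 := hnew t ⟨hle, htm.2⟩
        have e2 := h t₁ ⟨ht₁.1, le_rfl⟩
        have e3 := abs_add_le (D x' t - D x t₁) (D x t₁)
        rw [sub_add_cancel] at e3
        linarith
  have : Nonempty (Ioi (0 : ℝ)) := ⟨⟨1, one_pos (α := ℝ)⟩⟩
  -- A second use of compactness, now over all `ε > 0`.
  obtain ⟨x, hxm⟩ := IsCompact.nonempty_iInter_of_directed_nonempty_isCompact_isClosed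
    (fun ε : Ioi (0 : ℝ) => {x | ∀ t ∈ Icc t₀ T, |D x t| ≤ ε * (t - t₀)})
    (fun ε ε' => ⟨min ε ε',
      fun x h t htm => (h t htm).trans (mul_le_mul_of_nonneg_right
        (show ((min ε ε' : Ioi (0 : ℝ)) : ℝ) ≤ ε from min_le_left ε ε') (sub_nonneg.2 htm.1)),
      fun x h t htm => (h t htm).trans (mul_le_mul_of_nonneg_right
        (show ((min ε ε' : Ioi (0 : ℝ)) : ℝ) ≤ ε' from min_le_right ε ε') (sub_nonneg.2 htm.1))⟩)
    (fun ε => happrox ε ε.2) (fun ε => (hclosed ε T le_rfl).isCompact)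
    (fun ε => hclosed ε T le_rfl)
  rw [mem_iInter] at hxm
  refine ⟨x, fun t htm => ?_⟩
  rw [← abs_nonpos_iff]
  refine le_of_forall_pos_le_add fun ε hε => ?_
  have hpos : 0 < T - t₀ + 1 := by linarith
  -- The `+ 1` keeps the denominator positive when `t₀ = T`.
  refine (hxm ⟨ε / (T - t₀ + 1), div_pos hε hpos⟩ t htm).trans ?_
  simp only [zero_add]
  rw [div_mul_eq_mul_div, div_le_iff₀ hpos]
  nlinarith [htm.2]

/-! ### Characteristics determined by admissible paths -/

/-- The second component of the characteristic determined by the path `x`, on `[t₀, T]`. -/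
def charValue {n : ℕ} {T : ℝ} (α : ℝ) (H : ℝ → Vec n → Vec n → ℝ) (s : Vec n) (t₀ : ℝ)
    (x : C(Icc (0 : ℝ) T, Vec n)) (t : ℝ) : ℝ :=
  inner ℝ s (caputoInt α x t - caputoInt α x t₀) - ∫ τ in t₀..t, H τ (ext x τ) s

theorem HamiltonianAssumptions.continuousOn_slice {n : ℕ} {T cH : ℝ} {H : ℝ → Vec n → Vec n → ℝ}
    (hH : HamiltonianAssumptions T cH H) (s : Vec n) :
    ContinuousOn (fun y : ℝ × Vec n => H y.1 y.2 s) (Icc 0 T ×ˢ univ) :=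
  hH.continuousOn.comp (f := fun y : ℝ × Vec n => (y.1, y.2, s)) (by fun_prop)
    fun y hy => ⟨hy.1, mem_univ _⟩

theorem HamiltonianAssumptions.continuousOn_path {n : ℕ} {T cH : ℝ} {H : ℝ → Vec n → Vec n → ℝ}
    (hH : HamiltonianAssumptions T cH H) (s : Vec n) (x : C(Icc (0 : ℝ) T, Vec n)) :
    ContinuousOn (fun τ => H τ (ext x τ) s) (Icc 0 T) :=
  (hH.continuousOn_slice s).comp (f := fun τ => (τ, ext x τ))
    (continuousOn_id.prodMk (continuousOn_ext x)) fun _ hτ => ⟨hτ, mem_univ _⟩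

theorem HamiltonianAssumptions.intervalIntegrable_path {n : ℕ} {T cH : ℝ}
    {H : ℝ → Vec n → Vec n → ℝ} (hH : HamiltonianAssumptions T cH H) (s : Vec n)
    (x : C(Icc (0 : ℝ) T, Vec n)) {a b : ℝ} (ha : a ∈ Icc 0 T) (hb : b ∈ Icc 0 T) :
    IntervalIntegrable (fun τ => H τ (ext x τ) s) volume a b :=
  ((hH.continuousOn_path s x).mono (uIcc_subset_Icc ha hb)).intervalIntegrable

theorem charValue_sub {n : ℕ} {T cH α : ℝ} {H : ℝ → Vec n → Vec n → ℝ}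
    (hH : HamiltonianAssumptions T cH H) (s : Vec n) (x : C(Icc (0 : ℝ) T, Vec n)) {t₀ a b : ℝ}
    (ht₀ : t₀ ∈ Icc 0 T) (ha : a ∈ Icc 0 T) (hb : b ∈ Icc 0 T) :
    charValue α H s t₀ x b - charValue α H s t₀ x a =
      inner ℝ s (caputoInt α x b - caputoInt α x a) - ∫ τ in a..b, H τ (ext x τ) s := by
  rw [charValue, charValue, ← intervalIntegral.integral_interval_sub_left
    (hH.intervalIntegrable_path s x ht₀ hb) (hH.intervalIntegrable_path s x ht₀ ha)]
  simp only [inner_sub_right]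
  ring

theorem exists_lipschitzOn_charValue {n : ℕ} {T cH α : ℝ} {H : ℝ → Vec n → Vec n → ℝ}
    (hH : HamiltonianAssumptions T cH H) (s : Vec n) {x : C(Icc (0 : ℝ) T, Vec n)} {t₀ : ℝ}
    (ht₀ : t₀ ∈ Icc 0 T) {K : NNReal} (hK : LipschitzOnWith K (caputoInt α x) (Icc 0 T)) :
    ∃ L, LipschitzOnWith L (charValue α H s t₀ x) (Icc 0 T) := by
  obtain ⟨C, hC⟩ := isCompact_Icc.exists_bound_of_continuousOn (hH.continuousOn_path s x)
  have hC0 : 0 ≤ C := (norm_nonneg _).trans (hC t₀ ht₀)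
  refine ⟨‖s‖₊ * K + ⟨C, hC0⟩, LipschitzOnWith.of_dist_le_mul fun b hb a ha => ?_⟩
  rw [Real.dist_eq, charValue_sub hH s x ht₀ ha hb, Real.dist_eq]
  have h1 : |inner ℝ s (caputoInt α x b - caputoInt α x a)| ≤ ‖s‖ * (K * |b - a|) := by
    refine (abs_real_inner_le_norm _ _).trans (mul_le_mul_of_nonneg_left ?_ (norm_nonneg _))
    have := hK.dist_le_mul b hb a ha
    rwa [dist_eq_norm, Real.dist_eq] at this
  have h2 : |∫ τ in a..b, H τ (ext x τ) s| ≤ C * |b - a| :=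
    intervalIntegral.norm_integral_le_of_norm_le_const fun τ hτ =>
      hC τ (uIcc_subset_Icc ha hb (uIoc_subset_uIcc hτ))
  refine (abs_sub _ _).trans ((add_le_add h1 h2).trans (le_of_eq ?_))
  change _ = (‖s‖ * K + C) * |b - a|
  ring

theorem charValue_self {n : ℕ} {T : ℝ} (α : ℝ) (H : ℝ → Vec n → Vec n → ℝ) (s : Vec n) (t₀ : ℝ)
    (x : C(Icc (0 : ℝ) T, Vec n)) : charValue α H s t₀ x t₀ = 0 := by
  simp [charValue]

theorem charValue_congr {n : ℕ} {T : ℝ} {α : ℝ} {H : ℝ → Vec n → Vec n → ℝ} {s : Vec n}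
    {t₀ t : ℝ} {x x' : C(Icc (0 : ℝ) T, Vec n)} (ht₀ : 0 ≤ t₀) (ht : t₀ ≤ t)
    (h : ∀ τ ∈ Icc 0 t, ext x τ = ext x' τ) :
    charValue α H s t₀ x t = charValue α H s t₀ x' t := by
  rw [charValue, charValue, caputoInt_congr (ht₀.trans ht) h,
    caputoInt_congr ht₀ fun ξ hξ => h ξ ⟨hξ.1, hξ.2.trans ht⟩]
  congr 1
  refine intervalIntegral.integral_congr fun τ hτ => ?_
  rw [uIcc_of_le ht] at hτ
  simp only [h τ ⟨ht₀.trans hτ.1, hτ.2⟩]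

/-- Since `z` is a continuous function of `x` at each time, compactness in `x` alone suffices. -/
theorem continuous_charValue {n : ℕ} {T cH α : ℝ} {H : ℝ → Vec n → Vec n → ℝ}
    (hα : α ∈ Ioo (0 : ℝ) 1) (hH : HamiltonianAssumptions T cH H) (s : Vec n) {t₀ t : ℝ}
    (ht₀ : t₀ ∈ Icc 0 T) (ht : t ∈ Icc 0 T) :
    Continuous fun x : C(Icc (0 : ℝ) T, Vec n) => charValue α H s t₀ x t :=
  (continuous_const.inner ((continuous_caputoInt hα ht).sub (continuous_caputoInt hα ht₀))).sub
    (continuous_integral_ext ht₀ ht (g := fun τ v => H τ v s) (hH.continuousOn_slice s))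

/-- The `ACPath` of an admissible path. -/
def admissiblePath {T : ℝ} {n : ℕ} {α c : ℝ} (hT : 0 < T) (hα : α ∈ Ioo (0 : ℝ) 1) (hc : 0 ≤ c)
    {p : ACHist T n α} (x : admissible c p) : ACPath T n α :=
  ⟨x.1, (exists_lipschitzOn_of_mem hα hc x.2).elim fun _ hK => isAC_of_lipschitzOn hT hα hK⟩

theorem admissiblePath_extends {T : ℝ} {n : ℕ} {α c : ℝ} (hT : 0 < T) (hα : α ∈ Ioo (0 : ℝ) 1)
    (hc : 0 ≤ c) {p : ACHist T n α} (x : admissible c p) :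
    Extends (admissiblePath hT hα hc x) p :=
  extends_of_ext x.2.1

theorem mem_characteristics {T : ℝ} {n : ℕ} {α cH : ℝ} {H : ℝ → Vec n → Vec n → ℝ} (hT : 0 < T)
    (hα : α ∈ Ioo (0 : ℝ) 1) (hH : HamiltonianAssumptions T cH H) {p : ACHist T n α}
    (x : admissible cH p) (s : Vec n) :
    (admissiblePath hT hα hH.pos.le x,
      -- The `max` makes `z` equal to `0` up to `t₀` and preserves the Lipschitz constant.
      fun t : Icc (0 : ℝ) T => charValue α H s p.1.t x.1 (max (t : ℝ) p.1.t)) ∈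
        characteristics cH H p 0 s := by
  obtain ⟨K, hK⟩ := exists_lipschitzOn_of_mem hα hH.pos.le x.2
  obtain ⟨L, hL⟩ := exists_lipschitzOn_charValue hH s p.1.t.2 hK
  refine ⟨⟨L, LipschitzWith.of_dist_le_mul fun a b => ?_⟩, admissiblePath_extends hT hα hH.pos.le x,
    fun t ht => ?_, ?_⟩
  · refine (hL.dist_le_mul _ ⟨le_max_of_le_left a.2.1, max_le a.2.2 p.1.t.2.2⟩ _
      ⟨le_max_of_le_left b.2.1, max_le b.2.2 p.1.t.2.2⟩).trans
      (mul_le_mul_of_nonneg_left ?_ L.2)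
    rw [Subtype.dist_eq, Real.dist_eq, Real.dist_eq]
    exact abs_max_sub_max_le_abs _ _ _
  · simp only [max_eq_right ht, charValue_self]
  · rw [← restrict_Ioo_eq_restrict_Icc]
    refine (ae_restrict_iff' measurableSet_Ioo).2 ?_
    filter_upwards [ae_differentiableAt_of_lipschitzOn hK] with t htd ht
    have ht0 : 0 < t := p.1.t.2.1.trans_lt ht.1
    have hn : Icc 0 T ∈ nhds t := Icc_mem_nhds ht0 ht.2
    refine ⟨caputo_norm_le_of_mem hH.pos.le x.2 ht, ?_⟩
    have hd := (htd ⟨ht0, ht.2⟩).hasDerivAt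
    have h1 : HasDerivAt (fun u => inner ℝ s (caputoInt α x.1 u - caputoInt α x.1 p.1.t))
        (inner ℝ s (caputo α x.1 t)) t :=
      (innerSL ℝ s).hasFDerivAt.comp_hasDerivAt t (hd.sub_const _)
    have h2 := intervalIntegral.integral_hasDerivAt_right
      (hH.intervalIntegrable_path s x.1 p.1.t.2 ⟨ht0.le, ht.2.le⟩)
      ⟨Icc 0 T, hn, (hH.continuousOn_path s x.1).aestronglyMeasurable measurableSet_Icc⟩
      ((hH.continuousOn_path s x.1).continuousAt hn)
    refine HasDerivAt.deriv ((h1.sub h2).congr_of_eventuallyEq ?_)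
    filter_upwards [Ioo_mem_nhds ht.1 ht.2] with u hu
    have hu' : u ∈ Icc 0 T := ⟨p.1.t.2.1.trans hu.1.le, hu.2.le⟩
    simp only [ext_of_mem _ hu', max_eq_left hu.1.le]
    rfl

/-! ### The choice of velocity and the local step -/

/-- Take `e` parallel to `s - v`, with the length that the equation forces; the Lipschitz condition
on `H` is exactly the bound on this length. This `e` cancels the first-order increment of `φ - z`.
-/
theorem exists_velocity {n : ℕ} {T cH : ℝ} {H : ℝ → Vec n → Vec n → ℝ}
    (hH : HamiltonianAssumptions T cH H) {t : ℝ} (ht : t ∈ Icc 0 T) (x s v : Vec n) :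
    ∃ e : Vec n, ‖e‖ ≤ cH * (1 + ‖x‖) ∧ inner ℝ (s - v) e = H t x s - H t x v := by
  by_cases hd : s - v = 0
  · refine ⟨0, ?_, ?_⟩
    · rw [norm_zero]
      have := hH.pos
      positivity
    · rw [sub_eq_zero.1 hd]
      simp
  · have hn : 0 < ‖s - v‖ := norm_pos_iff.2 hd
    refine ⟨((H t x s - H t x v) / ‖s - v‖ ^ 2) • (s - v), ?_, ?_⟩
    · rw [norm_smul, Real.norm_eq_abs, abs_div, abs_of_pos (pow_pos hn 2), div_mul_eq_mul_div,
        div_le_iff₀ (pow_pos hn 2), pow_two, ← mul_assoc]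
      exact mul_le_mul_of_nonneg_right (hH.lipschitz_grad t ht x s v) hn.le
    · rw [real_inner_smul_right, real_inner_self_eq_norm_sq]
      field_simp

theorem exists_velocity_lt {n : ℕ} {T cH : ℝ} {H : ℝ → Vec n → Vec n → ℝ}
    (hH : HamiltonianAssumptions T cH H) {t : ℝ} (ht : t ∈ Icc 0 T) (x s v : Vec n) {ε : ℝ}
    (hε : 0 < ε) : ∃ e : Vec n, ‖e‖ < cH * (1 + ‖x‖) ∧
      |H t x s - H t x v - inner ℝ (s - v) e| ≤ ε := by
  obtain ⟨e, he, hi⟩ := exists_velocity hH ht x s v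
  set A := H t x s - H t x v with hA
  -- Shrinking `e` by `1 - η` makes its bound strict, as `exists_extension` requires; the inner
  -- product changes by `η |A| ≤ ε`.
  set η := ε / (|A| + ε) with hη
  have hA0 := abs_nonneg A
  have hden : 0 < |A| + ε := by linarith
  have hη0 : 0 < η := div_pos hε hden
  have hη1 : η ≤ 1 := (div_le_one hden).2 (by linarith)
  have hpos : 0 < cH * (1 + ‖x‖) := by
    have := hH.pos
    positivity
  refine ⟨(1 - η) • e, ?_, ?_⟩
  · rw [norm_smul, Real.norm_of_nonneg (by linarith)]
    nlinarith [norm_nonneg e]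
  · rw [real_inner_smul_right, hi, show A - (1 - η) * A = η * A by ring, abs_mul,
      abs_of_pos hη0, hη, div_mul_eq_mul_div, div_le_iff₀ hden]
    nlinarith

theorem exists_abs_integral_sub_le {f : ℝ → ℝ} {T t₁ : ℝ} (hf : ContinuousOn f (Icc 0 T))
    (ht₁ : t₁ ∈ Icc 0 T) {ε : ℝ} (hε : 0 < ε) : ∃ δ > 0, ∀ t, t₁ ≤ t → t ≤ T → t - t₁ < δ →
      |(∫ τ in t₁..t, f τ) - (t - t₁) * f t₁| ≤ ε * (t - t₁) := by
  obtain ⟨δ, hδ, hball⟩ := Metric.mem_nhdsWithin_iff.1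
    ((hf t₁ ht₁).eventually (Metric.ball_mem_nhds (f t₁) hε))
  refine ⟨δ, hδ, fun t h1 hT hd => ?_⟩
  have hi : IntervalIntegrable f volume t₁ t :=
    (hf.mono (uIcc_subset_Icc ht₁ ⟨ht₁.1.trans h1, hT⟩)).intervalIntegrable
  have e : (∫ τ in t₁..t, f τ) - (t - t₁) * f t₁ = ∫ τ in t₁..t, (f τ - f t₁) := by
    rw [intervalIntegral.integral_sub hi intervalIntegrable_const, intervalIntegral.integral_const,
      smul_eq_mul]
  rw [e, ← Real.norm_eq_abs, ← abs_of_nonneg (sub_nonneg.2 h1)]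
  refine intervalIntegral.norm_integral_le_of_norm_le_const fun τ hτ => ?_
  rw [uIoc_of_le h1] at hτ
  have hm : τ ∈ Metric.ball t₁ δ ∩ Icc 0 T := by
    refine ⟨?_, ht₁.1.trans hτ.1.le, hτ.2.trans hT⟩
    rw [Metric.mem_ball, Real.dist_eq, abs_of_pos (sub_pos.2 hτ.1)]
    linarith [hτ.2]
  have := hball hm
  exact (mem_ball_iff_norm.1 this).le

/-- Along a suitable continuation of an admissible path, a classical solution minus the second
component of the characteristic has small increments. -/
theorem exists_continuation {T : ℝ} {n : ℕ} {α cH : ℝ} {H : ℝ → Vec n → Vec n → ℝ} (hT : 0 < T)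
    (hα : α ∈ Ioo (0 : ℝ) 1) (hH : HamiltonianAssumptions T cH H) {φ : ACHist T n α → ℝ}
    {φt : ACHistInt T n α → ℝ} {φx : ACHistInt T n α → Vec n}
    (hφ : ∀ p, HasCiDerivAt φ p (φt p) (φx p))
    (hHJ : ∀ p, φt p + H p.1.1.t (ACHist.last p.1) (φx p) = 0) {p : ACHist T n α}
    (x : admissible cH p) (s : Vec n) {t₁ : Icc (0 : ℝ) T} (hpt : (p.1.t : ℝ) ≤ t₁)
    (ht₁ : (t₁ : ℝ) < T) {ε : ℝ} (hε : 0 < ε) :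
    ∃ x' : admissible cH p, ∃ δ > 0, (t₁ : ℝ) + δ ≤ T ∧
      (∀ τ ∈ Icc 0 (t₁ : ℝ), ext x'.1 τ = ext x.1 τ) ∧
      ∀ t : Icc (0 : ℝ) T, (t₁ : ℝ) ≤ t → (t : ℝ) ≤ t₁ + δ →
        |(φ ((admissiblePath hT hα hH.pos.le x').upTo t) - charValue α H s p.1.t x'.1 t) -
          (φ ((admissiblePath hT hα hH.pos.le x).upTo t₁) - charValue α H s p.1.t x.1 t₁)| ≤
          ε * ((t : ℝ) - t₁) := by
  -- One third each for the choice of `e`, the `ci`-differential of `φ` and the integral of `H`.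
  have hε3 : 0 < ε / 3 := by linarith
  set X := admissiblePath hT hα hH.pos.le x with hX
  let q : ACHistInt T n α := ⟨X.upTo t₁, ht₁⟩
  have hlast : ACHist.last q.1 = ext x.1 t₁ := (ext_of_mem x.1 t₁.2).symm
  have hq : φt q = - H t₁ (ext x.1 t₁) (φx q) := by
    have := hHJ q
    rw [hlast] at this
    exact eq_neg_of_add_eq_zero_left this
  obtain ⟨e, he, hei⟩ := exists_velocity_lt hH t₁.2 (ext x.1 t₁) s (φx q) hε3
  obtain ⟨x', hx', δ, hδ, hδT, hold, hnew⟩ :=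
    exists_extension hT hα hH.pos.le x.2 ⟨hpt, ht₁⟩ he
  set X' := admissiblePath hT hα hH.pos.le (⟨x', hx'⟩ : admissible cH p) with hX'
  -- Both paths have the same history at `t₁`, so the `ci`-derivatives at `q` apply to the
  -- continuation `X'`.
  have hup : X'.upTo t₁ = X.upTo t₁ := upTo_congr hold
  have hE : Extends X' q.1 := by
    have : Extends X' (X'.upTo t₁) := fun τ => rfl
    rwa [hup] at this
  obtain ⟨δ₁, hδ₁, hci⟩ := hφ q X' hE (ε / 3) hε3
  obtain ⟨δ₂, hδ₂, hint⟩ :=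
    exists_abs_integral_sub_le (hH.continuousOn_path s x') t₁.2 hε3
  obtain ⟨K, hK⟩ := exists_lipschitzOn_of_mem hα hH.pos.le hx'
  -- Halving turns `t ≤ t₁ + δ` into the strict inequalities needed for `δ₁`, `δ₂` and `t < T`.
  refine ⟨⟨x', hx'⟩, min δ (min δ₁ δ₂) / 2, by positivity, ?_, hold, fun t h1 h2 => ?_⟩
  · have := min_le_left δ (min δ₁ δ₂)
    linarith
  have hm : 0 < min δ (min δ₁ δ₂) := by positivity
  have hm0 := min_le_left δ (min δ₁ δ₂)
  have hm1 := (min_le_right δ (min δ₁ δ₂)).trans (min_le_left _ _)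
  have hm2 := (min_le_right δ (min δ₁ δ₂)).trans (min_le_right _ _)
  have hchar : charValue α H s p.1.t x.1 t₁ = charValue α H s p.1.t x' t₁ :=
    (charValue_congr p.1.t.2.1 hpt hold).symm
  rcases h1.eq_or_lt with heq | hlt
  · have : t = t₁ := Subtype.ext heq.symm
    subst this
    simp only
    rw [← hX', hup, hchar]
    simp
  have hcap : caputoInt α x' t - caputoInt α x' t₁ = ((t : ℝ) - t₁) • e := by
    rw [hnew t ⟨h1, by linarith⟩, caputoInt_congr t₁.2.1 hold, add_sub_cancel_left]
  have e1 : |φ (X'.upTo t) - φ (X.upTo t₁) - (φt q * ((t : ℝ) - t₁)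
      + ∫ τ in (t₁ : ℝ)..t, inner ℝ (φx q) (caputo α x' τ))| ≤ ε / 3 * ((t : ℝ) - t₁) :=
    hci t hlt (by linarith) (show (t : ℝ) - t₁ < δ₁ by linarith)
  have e2 := hint t h1 t.2.2 (by linarith)
  rw [caputo_eq_deriv, integral_inner_deriv_of_lipschitzOn hK t₁.2 t.2 h1, hcap,
    real_inner_smul_right, hq] at e1
  rw [hold t₁ ⟨t₁.2.1, le_rfl⟩] at e2
  have e3 : charValue α H s p.1.t x' t - charValue α H s p.1.t x' t₁ =
      ((t : ℝ) - t₁) * inner ℝ s e - ∫ τ in (t₁ : ℝ)..t, H τ (ext x' τ) s := by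
    rw [charValue_sub hH s x' p.1.t.2 t₁.2 t.2, hcap, real_inner_smul_right]
  have e4 := mul_le_mul_of_nonneg_left hei (sub_nonneg.2 h1)
  rw [← abs_of_nonneg (sub_nonneg.2 h1), ← abs_mul, abs_of_nonneg (sub_nonneg.2 h1),
    inner_sub_left] at e4
  simp only
  rw [hchar]
  -- Up to the three errors, the increment is `(t - t₁)` times `-H(v) + ⟨v, e⟩ - ⟨s, e⟩ + H(s)`,
  -- with `v = φx q`, which `e4` makes small.
  rw [abs_le] at e1 e2 e4 ⊢
  constructor <;> nlinarith [e1.1, e1.2, e2.1, e2.2, e4.1, e4.2]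

/-! ### The characteristic along which equality holds -/

theorem exists_characteristic {T : ℝ} {n : ℕ} {α cH : ℝ} {H : ℝ → Vec n → Vec n → ℝ} (hT : 0 < T)
    (hα : α ∈ Ioo (0 : ℝ) 1) (hH : HamiltonianAssumptions T cH H) {σ : ACPath T n α → ℝ}
    {φ : ACHist T n α → ℝ} (hφ : IsClassicalSolution H σ φ) (p : ACHist T n α) (s : Vec n) :
    ∃ y ∈ characteristics cH H p 0 s,
      ∀ t : Icc (0 : ℝ) T, (p.1.t : ℝ) ≤ t → φ (y.1.upTo t) - y.2 t = φ p := by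
  obtain ⟨φt, φx, hs, hHJ, -⟩ := hφ
  have hc := hH.pos.le
  have : CompactSpace (admissible cH p) :=
    isCompact_iff_compactSpace.1 (isCompact_admissible hT hα hc p)
  have : Nonempty (admissible cH p) := (admissible_nonempty hα hc p).to_subtype
  -- The defect whose vanishing is sought; `projIcc` only makes it defined for all real `t`.
  let D : admissible cH p → ℝ → ℝ := fun x t =>
    φ ((admissiblePath hT hα hc x).upTo (projIcc 0 T hT.le t)) - charValue α H s p.1.t x.1 t - φ p
  have hsub : Icc (p.1.t : ℝ) T ⊆ Icc 0 T := Icc_subset_Icc_left p.1.t.2.1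
  obtain ⟨x, hx⟩ : ∃ x, ∀ t ∈ Icc (p.1.t : ℝ) T, D x t = 0 := by
    refine exists_eq_zero_of_continuation p.1.t.2.2 (fun t ht => ?_) (fun x => ?_) (fun x => ?_)
      (fun ε hε x t₁ ht₁ => ?_)
    · have h1 : Continuous fun x : admissible cH p => admissiblePath hT hα hc x :=
        continuous_subtype_val.subtype_mk _
      exact ((hs.continuous.comp ((continuous_upTo_left _).comp h1)).sub
        ((continuous_charValue hα hH s p.1.t.2 (hsub ht)).comp continuous_subtype_val)).sub
        continuous_const
    · obtain ⟨K, hK⟩ := exists_lipschitzOn_of_mem hα hc x.2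
      obtain ⟨L, hL⟩ := exists_lipschitzOn_charValue hH s p.1.t.2 hK
      exact ((hs.continuous.comp ((continuous_upTo_right _).comp
        continuous_projIcc)).continuousOn.sub (hL.continuousOn.mono hsub)).sub continuousOn_const
    · simp only [D, projIcc_val, charValue_self, (admissiblePath_extends hT hα hc x).upTo_eq]
      ring
    · have ht₁' : t₁ ∈ Icc 0 T := hsub ⟨ht₁.1, ht₁.2.le⟩
      obtain ⟨x', δ, hδ, hδT, hold, hnew⟩ := exists_continuation hT hα hH hs.hasCiDerivAt hHJ x s
        (t₁ := ⟨t₁, ht₁'⟩) ht₁.1 ht₁.2 hε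
      refine ⟨x', δ, hδ, hδT, fun t ht => ?_, fun t ht => ?_⟩
      · have ht' : t ∈ Icc 0 T := hsub ⟨ht.1, ht.2.trans ht₁.2.le⟩
        have hold' : ∀ τ ∈ Icc 0 t, ext x'.1 τ = ext x.1 τ :=
          fun τ hτ => hold τ ⟨hτ.1, hτ.2.trans ht.2⟩
        simp only [D, projIcc_of_mem hT.le ht', charValue_congr p.1.t.2.1 ht.1 hold']
        rw [upTo_congr (t := ⟨t, ht'⟩) (x := admissiblePath hT hα hc x')
          (x' := admissiblePath hT hα hc x) hold']
      · have ht' : t ∈ Icc 0 T := ⟨ht₁'.1.trans ht.1, ht.2.trans hδT⟩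
        have := hnew ⟨t, ht'⟩ ht.1 ht.2
        simp only [D, projIcc_of_mem hT.le ht', projIcc_of_mem hT.le ht₁']
        rwa [sub_sub_sub_cancel_right]
  refine ⟨_, mem_characteristics hT hα hH x s, fun t ht => ?_⟩
  have := hx t ⟨ht, t.2.2⟩
  simp only [D, projIcc_val] at this
  simp only [max_eq_left ht]
  linarith

end FracHJ

end

/-- A single characteristic serves both stability conditions, for every `t` and every `ε`;
continuity of `φ` and its terminal values give the rest. -/
theorem mainTheorem3 {n : ℕ} {T α cH : ℝ} (hn : 1 ≤ n) (hT : 0 < T) (hα : α ∈ Set.Ioo (0 : ℝ) 1)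
    (H : ℝ → FracHJ.Vec n → FracHJ.Vec n → ℝ) (hH : FracHJ.HamiltonianAssumptions T cH H)
    (σ : FracHJ.ACPath T n α → ℝ) (hσ : Continuous σ)
    (φ : FracHJ.ACHist T n α → ℝ) (hφ : FracHJ.IsClassicalSolution H σ φ) :
    FracHJ.IsMinimaxSolution cH H σ φ ∧
      ∀ (p : FracHJ.ACHistInt T n α) (s : FracHJ.Vec n),
        ∃ y ∈ FracHJ.characteristics cH H p.1 0 s,
          ∀ t : Set.Icc (0 : ℝ) T, (p.1.1.t : ℝ) ≤ t → φ (y.1.upTo t) - y.2 t = φ p.1 := by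
  have hchar := fun (p : FracHJ.ACHistInt T n α) (s : FracHJ.Vec n) =>
    FracHJ.exists_characteristic hT hα hH hφ p.1 s
  obtain ⟨φt, φx, hs, -, hb⟩ := hφ
  refine ⟨⟨⟨hs.continuous.lowerSemicontinuous, fun w t ht => (hb w t ht).ge, ?_⟩,
    ⟨hs.continuous.upperSemicontinuous, fun w t ht => (hb w t ht).le, ?_⟩⟩, hchar⟩
  · intro p t ht s ε hε
    obtain ⟨y, hy, h⟩ := hchar p s
    exact ⟨y, hy, by linarith [h t ht.le]⟩
  · intro p t ht s ε hε
    obtain ⟨y, hy, h⟩ := hchar p s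
    exact ⟨y, hy, by linarith [h t ht.le]⟩
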